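/- A stable matching (SM) instance of size $n$ consists of $n$ men and $n$ women, each with a strict preference list of some agents of the other side; lists may be incomplete, but they are consistent ($a$ is on $b$'s list iff $b$ is on $a$'s list) and every agent is matched in every stable matching. The instance is complete if all lists contain the whole other side. A matching is a set of mutually acceptable pairs in which every agent occurs at most once; it is stable if there is no acceptable pair $(m,w)$ in which each is unmatched or prefers the other to the current partner. A rotation exposed in a stable matching $\mu$ is a circular list $\rho=(m_1,w_1),\dots,(m_\ell,w_\ell)$ of distinct pairs of $\mu$ such that, for all $i$ (cyclically), $w_{i+1}$ is the first woman after $w_i$ on $m_i$'s list who prefers $m_i$ to her partner in $\mu$. Eliminating $\rho$ replaces the pairs $(m_i,w_i)$ of $\mu$ by the pairs $(m_i,w_{i+1})$. The rotation poset of an instance is the set of all rotations exposed in its stable matchings, where $\rho$ strictly precedes $\rho'$ if, for every stable matching $\mu$ in which $\rho'$ is exposed, $\rho$ belongs to the set $R_\mu$ of rotations that are eliminated on the way from the man-optimal stable matching to $\mu$. An instance realizes a poset $\mathcal P$ if its rotation poset is isomorphic to $\mathcal P$. A complete instance has $(k_1,k_2)$-list preferences if the men and the women can be partitioned into at most $k_1$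 and at most $k_2$ groups, respectively, such that all agents of a group have the same preference list; $\infty$ means that the number of groups is arbitrary. **Theorem.** Let $\mathcal P$ be a finite poset whose Hasse diagram $H(\mathcal P)$ has $p$ vertices and $q$ edges. 1. There is an SM instance $I(\mathcal P)$ (in general with incomplete lists) that realizes $\mathcal P$, such that there are two complete lists of the women of which every man's list is a sublist of one, and two complete lists of the men of which every woman's list is a sublist of one. It has $O(p+q)$ agents and, given $H(\mathcal P)$, can be constructed in $O(p+q)$ time. 2. There is an SM instance $I_L(\mathcal P)$ with $(2,\infty)$-list preferences (the men split into at most two groups, each sharing one complete list) that realizes $\mathcal P$. It has $O(p+q)$ agents and, given $H(\mathcal P)$, can be constructed in $O((p+q)^2)$ time. 3. There is an SM instance $I_{L'}(\mathcal P)$ with $(\infty,2)$-list preferences that realizes $\mathcal P$. It has $O(p+q)$ agents and, given $H(\mathcal P)$, can be constructed in $O((p+q)^2)$ time. Here "constructed in $O(T)$ time" means that, for each part, a single random access machine program, for all posets, given $p$, $q$ and the edges of $H(\mathcal P)$ in arbitrary order over an arbitrary numbering of the vertices, writes down all preference lists of the instance within $O(T+1)$ unit-cost steps. The constants in $O(\cdot)$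 do not depend on $\mathcal P$. -/

import Mathlib

universe u

/-! ### Stable matching instances -/

/-- `Prefers L a b`: an agent with preference list `L` strictly prefers `a` to `b`, i.e. `a` is on the
list and either precedes `b` or `b` is not on the list.  (`List.idxOf` returns the length of the list
on absent entries.) -/
def Prefers {n : ℕ} (L : List (Fin n)) (a b : Fin n) : Prop :=
  L.idxOf a < L.idxOf b

/-- Preference lists, best partner first, of `n` men and `n` women, both numbered by `Fin n`. -/
structure Preferences (n : ℕ) where
  man : Fin n → List (Fin n)
  woman : Fin n → List (Fin n)

namespace Preferences

variable {n : ℕ}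

/-- The man `m` and the woman `w` are acceptable to each other. -/
def Acceptable (P : Preferences n) (m w : Fin n) : Prop :=
  w ∈ P.man m ∧ m ∈ P.woman w

/-- A matching is a set of acceptable (man, woman) pairs; every agent is in at most one of them. -/
structure IsMatching (P : Preferences n) (μ : Set (Fin n × Fin n)) : Prop where
  acceptable : ∀ m w, (m, w) ∈ μ → P.Acceptable m w
  man_unique : ∀ m w w', (m, w) ∈ μ → (m, w') ∈ μ → w = w'
  woman_unique : ∀ m m' w, (m, w) ∈ μ → (m', w) ∈ μ → m = m'

/-- An acceptable pair blocks `μ` if each of the two is unmatched in `μ` or prefers the other one to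
the partner in `μ`. -/
def Blocks (P : Preferences n) (μ : Set (Fin n × Fin n)) (m w : Fin n) : Prop :=
  P.Acceptable m w ∧
    (∀ w', (m, w') ∈ μ → Prefers (P.man m) w w') ∧
    (∀ m', (m', w) ∈ μ → Prefers (P.woman w) m m')

/-- Stable matchings. -/
def IsStable (P : Preferences n) (μ : Set (Fin n × Fin n)) : Prop :=
  P.IsMatching μ ∧ ∀ m w, ¬ P.Blocks μ m w

end Preferences

/-- A stable matching instance of size `n`, possibly with incomplete lists: the preference lists have
no repetitions and are consistent, and all agents are matched in every stable matching. -/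
structure SMInstance (n : ℕ) extends Preferences n where
  man_nodup : ∀ m, (man m).Nodup
  woman_nodup : ∀ w, (woman w).Nodup
  consistent : ∀ m w, w ∈ man m ↔ m ∈ woman w
  man_matched : ∀ μ, toPreferences.IsStable μ → ∀ m, ∃ w, (m, w) ∈ μ
  woman_matched : ∀ μ, toPreferences.IsStable μ → ∀ w, ∃ m, (m, w) ∈ μ

/-! ### Rotations and the rotation poset -/

/-- The elimination `μ \ ρ` of the circular list `ρ = (m₁, w₁), …, (m_ℓ, w_ℓ)` of distinct pairs: the
pairs of `ρ` are removed from `μ` and the pairs `(m_i, w_{i+1})` are added. -/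
def eliminate {n : ℕ} (μ : Set (Fin n × Fin n)) (ρ : Cycle (Fin n × Fin n)) (hρ : ρ.Nodup) :
    Set (Fin n × Fin n) :=
  {x | x ∈ μ ∧ x ∉ ρ} ∪ {x | ∃ a, ∃ ha : a ∈ ρ, x = (a.1, (ρ.next hρ a ha).2)}

namespace SMInstance

variable {n : ℕ}

/-- For pairs `(m, w)` and `(m', w')` of `μ`: the woman `w'` is the first one after `w` on the list of
`m` who prefers `m` to her partner in `μ`, which is `m'`. -/
def IsSuccessor (I : SMInstance n) (μ : Set (Fin n × Fin n)) (a b : Fin n × Fin n) : Prop :=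
  Prefers (I.man a.1) a.2 b.2 ∧
    Prefers (I.woman b.2) a.1 b.1 ∧
    ¬ ∃ w m', (m', w) ∈ μ ∧ Prefers (I.man a.1) a.2 w ∧ Prefers (I.man a.1) w b.2 ∧
      Prefers (I.woman w) a.1 m'

/-- The circular list `ρ` is a rotation exposed in the stable matching `μ`. -/
def IsExposed (I : SMInstance n) (μ : Set (Fin n × Fin n)) (ρ : Cycle (Fin n × Fin n)) : Prop :=
  I.IsStable μ ∧ ρ ≠ Cycle.nil ∧
    ∃ hρ : ρ.Nodup, ∀ a, ∀ ha : a ∈ ρ, a ∈ μ ∧ I.IsSuccessor μ a (ρ.next hρ a ha)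

/-- The man-optimal stable matching: no man has a stable partner whom he prefers to his partner in
`μ`. -/
def IsManOptimal (I : SMInstance n) (μ : Set (Fin n × Fin n)) : Prop :=
  I.IsStable μ ∧
    ∀ μ', I.IsStable μ' → ∀ m w w', (m, w) ∈ μ → (m, w') ∈ μ' → ¬ Prefers (I.man m) w' w

/-- `I.EliminationSeq l μ`: one obtains `μ` from the man-optimal stable matching by successively
eliminating exposed rotations; `l` lists them, the last one first. -/
inductive EliminationSeq (I : SMInstance n) :
    List (Cycle (Fin n × Fin n)) → Set (Fin n × Fin n) → Prop
  | start (μ : Set (Fin n × Fin n)) : I.IsManOptimal μ → EliminationSeq I [] μ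
  | step (l : List (Cycle (Fin n × Fin n))) (μ : Set (Fin n × Fin n))
      (ρ : Cycle (Fin n × Fin n)) (hρ : ρ.Nodup) :
      EliminationSeq I l μ → I.IsExposed μ ρ → EliminationSeq I (ρ :: l) (eliminate μ ρ hρ)

/-- The set `R_μ` of the rotations that are eliminated on the way from the man-optimal stable matching
to `μ`. -/
def eliminated (I : SMInstance n) (μ : Set (Fin n × Fin n)) : Set (Cycle (Fin n × Fin n)) :=
  {ρ | ∃ l, I.EliminationSeq l μ ∧ ρ ∈ l}

/-- The set of the rotations that are exposed in some stable matching. -/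
def rotations (I : SMInstance n) : Set (Cycle (Fin n × Fin n)) :=
  {ρ | ∃ μ, I.IsExposed μ ρ}

/-- The strict order of the rotation poset: `ρ` has been eliminated in every stable matching in which
`ρ'` is exposed. -/
def Precedes (I : SMInstance n) (ρ ρ' : Cycle (Fin n × Fin n)) : Prop :=
  ∀ μ, I.IsExposed μ ρ' → ρ ∈ I.eliminated μ

/-- The rotation poset of `I` is isomorphic to the poset `X`. -/
def Realizes (I : SMInstance n) (X : Type u) [PartialOrder X] : Prop :=
  ∃ f : X ≃ I.rotations, ∀ x y, x < y ↔ I.Precedes (f x) (f y)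

end SMInstance

/-! ### List preferences -/

/-- A complete list of the `n` agents of one side. -/
def IsCompleteList {n : ℕ} (L : List (Fin n)) : Prop :=
  L.Nodup ∧ ∀ a, a ∈ L

/-- The agents of one side can be partitioned into at most `k` groups such that all agents of a group
have the same preference list. -/
def InGroups {n : ℕ} (k : ℕ∞) (pref : Fin n → List (Fin n)) : Prop :=
  ∃ g : Fin n → ℕ, (Set.range g).encard ≤ k ∧ ∀ i j, g i = g j → pref i = pref j

/-- All preference lists of one side are sublists of two complete lists. -/
def SublistsOfTwo {n : ℕ} (pref : Fin n → List (Fin n)) : Prop :=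
  ∃ L₁ L₂ : List (Fin n), IsCompleteList L₁ ∧ IsCompleteList L₂ ∧
    ∀ i, List.Sublist (pref i) L₁ ∨ List.Sublist (pref i) L₂

/-- `(k₁, k₂)`-list preferences (with complete lists); `⊤` allows arbitrarily many groups. -/
def SMInstance.HasListPreferences {n : ℕ} (k₁ k₂ : ℕ∞) (I : SMInstance n) : Prop :=
  (∀ m, IsCompleteList (I.man m)) ∧ (∀ w, IsCompleteList (I.woman w)) ∧
    InGroups k₁ I.man ∧ InGroups k₂ I.woman

/-! ### The machine model

A random access machine with finitely many registers in use and finitely many zero-initialised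
two-dimensional arrays, with structured control flow and unit cost for every instruction and every
test.  The only arithmetic is `± 1`, so within `t` steps numbers grow by at most `O(t)`: no unit-cost
operation acts on long words. -/

/-- `reg x` is the content of register `x`, and `mem a i j` that of cell `(i, j)` of array `a`. -/
structure MachineState where
  reg : ℕ → ℕ
  mem : ℕ → ℕ → ℕ → ℕ

namespace MachineState

def setReg (s : MachineState) (x k : ℕ) : MachineState :=
  ⟨Function.update s.reg x k, s.mem⟩

def setMem (s : MachineState) (a i j k : ℕ) : MachineState :=
  ⟨s.reg, Function.update s.mem a
    (Function.update (s.mem a) i (Function.update (s.mem a i) j k))⟩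

end MachineState

/-- Programs.  The arguments `x y z i j` are names of registers, and `a` is the name of an array. -/
inductive Program where
  /-- do nothing -/
  | skip
  /-- `x := k` for a constant `k` -/
  | const (x k : ℕ)
  /-- `x := y` -/
  | copy (x y : ℕ)
  /-- `x := y + 1` -/
  | inc (x y : ℕ)
  /-- `x := y - 1` (truncated) -/
  | dec (x y : ℕ)
  /-- `x := a[i][j]` -/
  | load (x a i j : ℕ)
  /-- `a[i][j] := x` -/
  | store (a i j x : ℕ)
  /-- `c; d` -/
  | seq (c d : Program)
  /-- `if x < y then c else d` -/
  | ifLT (x y : ℕ) (c d : Program)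
  /-- `while x < y do c` -/
  | whileLT (x y : ℕ) (c : Program)

/-- `Runs c s t s'`: started in state `s`, the program `c` halts after exactly `t` steps in state
`s'`. -/
inductive Runs : Program → MachineState → ℕ → MachineState → Prop
  | skip (s : MachineState) : Runs .skip s 1 s
  | const (s : MachineState) (x k : ℕ) : Runs (.const x k) s 1 (s.setReg x k)
  | copy (s : MachineState) (x y : ℕ) : Runs (.copy x y) s 1 (s.setReg x (s.reg y))
  | inc (s : MachineState) (x y : ℕ) : Runs (.inc x y) s 1 (s.setReg x (s.reg y + 1))
  | dec (s : MachineState) (x y : ℕ) : Runs (.dec x y) s 1 (s.setReg x (s.reg y - 1))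
  | load (s : MachineState) (x a i j : ℕ) :
      Runs (.load x a i j) s 1 (s.setReg x (s.mem a (s.reg i) (s.reg j)))
  | store (s : MachineState) (a i j x : ℕ) :
      Runs (.store a i j x) s 1 (s.setMem a (s.reg i) (s.reg j) (s.reg x))
  | seq (c d : Program) (s s' s'' : MachineState) (t t' : ℕ) :
      Runs c s t s' → Runs d s' t' s'' → Runs (.seq c d) s (t + t') s''
  | ifLT_true (x y : ℕ) (c d : Program) (s s' : MachineState) (t : ℕ) :
      s.reg x < s.reg y → Runs c s t s' → Runs (.ifLT x y c d) s (t + 1) s'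
  | ifLT_false (x y : ℕ) (c d : Program) (s s' : MachineState) (t : ℕ) :
      ¬ s.reg x < s.reg y → Runs d s t s' → Runs (.ifLT x y c d) s (t + 1) s'
  | while_true (x y : ℕ) (c : Program) (s s' s'' : MachineState) (t t' : ℕ) :
      s.reg x < s.reg y → Runs c s t s' → Runs (.whileLT x y c) s' t' s'' →
      Runs (.whileLT x y c) s (t + t' + 1) s''
  | while_false (x y : ℕ) (c : Program) (s : MachineState) :
      ¬ s.reg x < s.reg y → Runs (.whileLT x y c) s 1 s

/-! ### Input and output -/

/-- `E` lists, in some order and without repetitions, the edges `(i, j)` of the Hasse diagram of the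
poset `X`, whose vertices are numbered by `v`. -/
def IsHasseDiagram {X : Type u} [PartialOrder X] {p q : ℕ} (v : Fin p ≃ X)
    (E : Fin q → Fin p × Fin p) : Prop :=
  Function.Injective E ∧ ∀ i j, (i, j) ∈ Set.range E ↔ v i ⋖ v j

/-- The digraph with vertices `0, …, p - 1` and edge list `E` as an input: `p` and `q` are in the
registers `0` and `1`, edge number `k` goes from `mem 0 k 0` to `mem 0 k 1`, and everything else is
`0`. -/
def inputState {p q : ℕ} (E : Fin q → Fin p × Fin p) : MachineState where
  reg x := if x = 0 then p else if x = 1 then q else 0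
  mem a k j :=
    if h : a = 0 ∧ k < q then
      if j = 0 then ((E ⟨k, h.2⟩).1 : ℕ) else if j = 1 then ((E ⟨k, h.2⟩).2 : ℕ) else 0
    else 0

/-- Row `i` of the array `A` holds the length of the list `pref i`, followed by its entries. -/
def HoldsLists {n : ℕ} (A : ℕ → ℕ → ℕ) (pref : Fin n → List (Fin n)) : Prop :=
  ∀ i : Fin n, A i 0 = (pref i).length ∧
    ∀ k, ∀ hk : k < (pref i).length, A i (k + 1) = ((pref i)[k] : ℕ)

/-- The state `s` holds the instance `I` as an output: its size is in register `0`, the lists of the men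
are in array `1` and those of the women in array `2`. -/
def IsOutput {n : ℕ} (s : MachineState) (I : SMInstance n) : Prop :=
  s.reg 0 = n ∧ HoldsLists (s.mem 1) I.man ∧ HoldsLists (s.mem 2) I.woman

/-- A single program that is given the Hasse diagram of an arbitrary finite poset, with `p` vertices and
`q` edges, constructs in `O (T (p + q))` steps an instance that realizes the poset, has `O (p + q)`
agents and satisfies `Q`.  (The term `+ 1` only matters for the empty poset.) -/
def ConstructsRealizers (T : ℕ → ℕ) (Q : ∀ n : ℕ, SMInstance n → Prop) : Prop :=
  ∃ (c : Program) (K : ℕ),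
    ∀ (X : Type u) [PartialOrder X] (p q : ℕ) (v : Fin p ≃ X) (E : Fin q → Fin p × Fin p),
      IsHasseDiagram v E →
      ∃ (n : ℕ) (I : SMInstance n) (t : ℕ) (s : MachineState),
        Q n I ∧ I.Realizes X ∧ n + n ≤ K * (p + q) ∧
        Runs c (inputState E) t s ∧ t ≤ K * (T (p + q) + 1) ∧ IsOutput s I

/-! Every x of the poset gets three men and three women with cyclic preferences: man (k,x) likes
woman (k+1,x) best and (k+2,x) next, and woman (k,x) likes man (k+1,x) best and (k+2,x) next. Such a
gadget has two states, men happy or women happy, and one rotation of length three leads from the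
first to the second. A covering x ⋖ y adds the pair of man (0,y) and woman (0,x), each between the
two own partners of the other. It blocks exactly if y has been rotated and x has not. Hence the
stable matchings correspond to the down-sets of the poset (`eq_gadgetMatching`,
`gadgetMatching_isStable`), the rotations to its elements (`exists_eq_gadgetRotation`), and the
precedence of rotations to the given order (`realizes`).

Only the incomplete lists consist of these pairs alone. For complete lists, the agents of one side
append all missing entries at the end, so every further pair is ranked by one of its agents below
both own partners. It remains to exclude stable matchings and rotations that use such pairs. The
agents of the other side share two block-ordered lists, in which every agent stands earliest in the
list of the one whose first choice he or she is (`fullPosition_lt`). The position of the first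
choice is therefore a potential φ that falls along any chain of agents who get more than their first
choice, so no such chain can go on forever.

The edges arrive in arbitrary order. Transposing the adjacency lists twice sorts them in linear time
(`establishes_coreLists`), which makes every incomplete list a sublist of a complete block-ordered
one. Completing all lists takes quadratic time, which is also the size of the output. -/

/-! ### Preferences, stability and cycles. -/

theorem Prefers.trichotomy {n : ℕ} {L : List (Fin n)} {a b : Fin n} (ha : a ∈ L) (hab : a ≠ b) :
    Prefers L a b ∨ Prefers L b a :=
  lt_or_gt_of_ne fun h => hab ((List.idxOf_inj ha).1 h)

theorem Prefers.mem {n : ℕ} {L : List (Fin n)} {a b : Fin n} (h : Prefers L a b) : a ∈ L :=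
  List.idxOf_lt_length_iff.1 (lt_of_lt_of_le h List.idxOf_le_length)

theorem Prefers.trans {n : ℕ} {L : List (Fin n)} {a b c : Fin n} (h : Prefers L a b)
    (h' : Prefers L b c) : Prefers L a c :=
  Nat.lt_trans h h'

theorem Prefers.asymm {n : ℕ} {L : List (Fin n)} {a b : Fin n} (h : Prefers L a b) :
    ¬ Prefers L b a :=
  Nat.lt_asymm h

theorem Prefers.irrefl {n : ℕ} {L : List (Fin n)} {a : Fin n} : ¬ Prefers L a a :=
  Nat.lt_irrefl _

/-- Stability in positive form: an acceptable pair outside μ has a witness, a better partner of one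
of its agents. Acceptability puts both agents on the lists, so "not preferred" can be turned around.
-/
theorem Preferences.IsStable.cases {n : ℕ} {P : Preferences n} {μ : Set (Fin n × Fin n)}
    (h : P.IsStable μ) {m w : Fin n} (hmw : P.Acceptable m w) :
    (m, w) ∈ μ ∨ (∃ w', (m, w') ∈ μ ∧ Prefers (P.man m) w' w) ∨
      ∃ m', (m', w) ∈ μ ∧ Prefers (P.woman w) m' m := by
  by_contra! hc
  obtain ⟨h1, h2, h3⟩ := hc
  refine h.2 m w ⟨hmw, fun w' hw' => ?_, fun m' hm' => ?_⟩
  · exact (Prefers.trichotomy hmw.1 (by rintro rfl; exact h1 hw')).resolve_right (h2 w' hw')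
  · exact (Prefers.trichotomy hmw.2 (by rintro rfl; exact h1 hm')).resolve_right (h3 m' hm')

theorem Cycle.exists_eq_cons {α : Type*} {ρ : Cycle α} {a : α} (ha : a ∈ ρ) :
    ∃ l : List α, ρ = (a :: l : List α) := by
  induction ρ using Quotient.inductionOn with
  | _ l =>
  obtain ⟨s, t, rfl⟩ := List.append_of_mem (show a ∈ l from ha)
  exact ⟨t ++ s, Cycle.coe_eq_coe.2 ⟨s.length, by simp⟩⟩

/-- Rotate the cycle so that it begins with a. Lengths one and two contradict the distinctness of a
from b and c; in a longer cycle than three, c would be followed by a fourth entry instead of a. -/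
theorem Cycle.eq_of_next_three {α : Type*} [DecidableEq α] {ρ : Cycle α} (hρ : ρ.Nodup)
    {a b c : α} (hab : a ≠ b) (hac : a ≠ c) (ha : a ∈ ρ) (hb : b ∈ ρ) (hc : c ∈ ρ)
    (h1 : ρ.next hρ a ha = b) (h2 : ρ.next hρ b hb = c) (h3 : ρ.next hρ c hc = a) :
    ρ = ([a, b, c] : List α) := by
  obtain ⟨l, rfl⟩ := Cycle.exists_eq_cons ha
  have hn : (a :: l).Nodup := hρ
  have key : ∀ (i : ℕ) (hi : i < (a :: l).length) (x : α) (hx : x ∈ a :: l), x = (a :: l)[i] →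
      List.next (a :: l) x hx = (a :: l)[(i + 1) % (a :: l).length]'(Nat.mod_lt _ (by simp)) := by
    rintro i hi x hx rfl
    exact List.next_getElem _ hn i hi
  change List.next (a :: l) a ha = b at h1
  change List.next (a :: l) b hb = c at h2
  change List.next (a :: l) c hc = a at h3
  rcases l with _ | ⟨b', _ | ⟨c', _ | ⟨d, l'⟩⟩⟩
  · rw [key 0 (by simp) a ha rfl] at h1
    exact absurd h1 (by simpa using hab)
  · rw [key 0 (by simp) a ha rfl] at h1
    obtain rfl : b' = b := by simpa using h1
    rw [key 1 (by simp) b' hb rfl] at h2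
    exact absurd h2 (by simpa using hac)
  · rw [key 0 (by simp) a ha rfl] at h1
    obtain rfl : b' = b := by simpa using h1
    rw [key 1 (by simp) b' hb rfl] at h2
    obtain rfl : c' = c := by simpa using h2
    rfl
  · rw [key 0 (by simp) a ha rfl] at h1
    obtain rfl : b' = b := by simpa [Nat.mod_eq_of_lt] using h1
    rw [key 1 (by simp) b' hb rfl] at h2
    obtain rfl : c' = c := by
      have : (1 + 1) % (l'.length + 1 + 1 + 1 + 1) = 2 := Nat.mod_eq_of_lt (by omega)
      simpa [this] using h2
    rw [key 2 (by simp) c' hc rfl] at h3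
    have : (2 + 1) % (l'.length + 1 + 1 + 1 + 1) = 3 := Nat.mod_eq_of_lt (by omega)
    simp only [List.length_cons, this] at h3
    simp at h3
    simp [h3] at hn

/-! ### A gadget of three men and three women per element of a poset -/

/-- The agents `(k, x)` of either side form the gadget of `x`; both the man and the woman `(k, x)`
rank `(k + 1, x)` above `(k + 2, x)`.  A covering `x ⋖ y` is encoded by the pair of the man `(0, y)`
and the woman `(0, x)`, each ranking the other one between the two partners from the own gadget.  All
other pairs are harmless: for one of the two agents, the other one is worse than the own gadget. -/
structure IsGadget {n : ℕ} {X : Type u} [PartialOrder X] (P : Preferences n)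
    (e : Fin 3 × X ≃ Fin n) (φ : Fin 3 → X → ℕ) : Prop where
  consistent : ∀ m w, w ∈ P.man m ↔ m ∈ P.woman w
  man_own : ∀ k x, Prefers (P.man (e (k, x))) (e (k + 1, x)) (e (k + 2, x))
  woman_own : ∀ k x, Prefers (P.woman (e (k, x))) (e (k + 1, x)) (e (k + 2, x))
  man_cover : ∀ x y, x ⋖ y → Prefers (P.man (e (0, y))) (e (1, y)) (e (0, x)) ∧
    Prefers (P.man (e (0, y))) (e (0, x)) (e (2, y))
  woman_cover : ∀ x y, x ⋖ y → Prefers (P.woman (e (0, x))) (e (1, x)) (e (0, y)) ∧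
    Prefers (P.woman (e (0, x))) (e (0, y)) (e (2, x))
  -- φ is a potential. A harmless pair in a stable matching forces an own partner of the agent who
  -- dislikes it to get someone better than the first choice, again in a harmless pair; the
  -- inequalities make φ drop along this chain.
  harmless : ∀ k x j y, e (j, y) ∈ P.man (e (k, x)) →
    (y = x ∧ j = k + 1) ∨ (y = x ∧ j = k + 2) ∨ (k = 0 ∧ j = 0 ∧ y ⋖ x) ∨
    (Prefers (P.woman (e (j, y))) (e (j + 2, y)) (e (k, x)) ∧
      (Prefers (P.man (e (k, x))) (e (j, y)) (e (k + 1, x)) → φ (j + 2) y < φ k x)) ∨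
    (Prefers (P.man (e (k, x))) (e (k + 2, x)) (e (j, y)) ∧
      (Prefers (P.woman (e (j, y))) (e (k, x)) (e (j + 1, y)) → φ k x < φ (j + 1) y))

/-- The matching in which exactly the men of the gadgets of `s` have their second choice. -/
def gadgetMatching {n : ℕ} {X : Type u} (e : Fin 3 × X ≃ Fin n) (s : Set X) :
    Set (Fin n × Fin n) :=
  {a | ∃ k x, (x ∉ s ∧ a = (e (k, x), e (k + 1, x))) ∨ (x ∈ s ∧ a = (e (k, x), e (k + 2, x)))}

/-- The rotation of the gadget of `x`. -/
def gadgetRotation {n : ℕ} {X : Type u} (e : Fin 3 × X ≃ Fin n) (x : X) : Cycle (Fin n × Fin n) :=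
  ([(e (0, x), e (1, x)), (e (1, x), e (2, x)), (e (2, x), e (0, x))] : List (Fin n × Fin n))

/-- `s` contains every element that is covered by one of its elements. -/
def CoverClosed {X : Type u} [PartialOrder X] (s : Set X) : Prop :=
  ∀ x y, x ⋖ y → y ∈ s → x ∈ s

/-! ### The matchings and rotations of the gadgets. -/

section Matching

variable {n : ℕ} {X : Type u} (e : Fin 3 × X ≃ Fin n) (s : Set X)

theorem gadgetMatching_first {x : X} (hx : x ∉ s) (k : Fin 3) :
    (e (k, x), e (k + 1, x)) ∈ gadgetMatching e s := ⟨k, x, .inl ⟨hx, rfl⟩⟩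

theorem gadgetMatching_second {x : X} (hx : x ∈ s) (k : Fin 3) :
    (e (k, x), e (k + 2, x)) ∈ gadgetMatching e s := ⟨k, x, .inr ⟨hx, rfl⟩⟩

theorem gadgetMatching_man {k : Fin 3} {x : X} {w : Fin n} :
    (e (k, x), w) ∈ gadgetMatching e s ↔
      (x ∉ s ∧ w = e (k + 1, x)) ∨ (x ∈ s ∧ w = e (k + 2, x)) := by
  constructor
  · rintro ⟨k', x', ⟨h, h'⟩ | ⟨h, h'⟩⟩ <;>
    · obtain ⟨h1, h2⟩ := Prod.mk.inj h'
      obtain ⟨rfl, rfl⟩ := Prod.mk.inj (e.injective h1)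
      simp [h, h2]
  · rintro (⟨h, rfl⟩ | ⟨h, rfl⟩)
    · exact gadgetMatching_first e s h k
    · exact gadgetMatching_second e s h k

theorem gadgetMatching_woman {k : Fin 3} {x : X} {m : Fin n} :
    (m, e (k, x)) ∈ gadgetMatching e s ↔
      (x ∉ s ∧ m = e (k + 2, x)) ∨ (x ∈ s ∧ m = e (k + 1, x)) := by
  obtain ⟨⟨j, y⟩, rfl⟩ := e.surjective m
  rw [gadgetMatching_man]
  simp only [e.injective.eq_iff, Prod.mk.injEq]
  have h1 : k = j + 1 ↔ j = k + 2 := by revert j k; decide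
  have h2 : k = j + 2 ↔ j = k + 1 := by revert j k; decide
  rw [h1, h2]
  constructor <;>
  · rintro (⟨h, h', rfl⟩ | ⟨h, h', rfl⟩) <;> simp [h, h']

theorem gadgetMatching_injective : Function.Injective (gadgetMatching e) := by
  intro s t h
  ext x
  have h1 : ∀ r : Set X, x ∈ r ↔ (e (0, x), e (2, x)) ∈ gadgetMatching e r := by
    intro r
    rw [gadgetMatching_man]
    simp
  rw [h1, h1, h]

theorem mem_gadgetRotation {x : X} {a : Fin n × Fin n} :
    a ∈ gadgetRotation e x ↔ ∃ k, a = (e (k, x), e (k + 1, x)) := by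
  simp only [gadgetRotation, Cycle.mem_coe_iff, List.mem_cons, List.not_mem_nil, or_false]
  constructor
  · rintro (rfl | rfl | rfl)
    exacts [⟨0, rfl⟩, ⟨1, rfl⟩, ⟨2, rfl⟩]
  · rintro ⟨k, rfl⟩
    fin_cases k <;> simp

theorem gadgetRotation_injective : Function.Injective (gadgetRotation e) := by
  intro x y h
  have := (mem_gadgetRotation e (x := x)).2 ⟨0, rfl⟩
  rw [h, mem_gadgetRotation] at this
  obtain ⟨k, hk⟩ := this
  exact (Prod.mk.inj (e.injective (Prod.mk.inj hk).1)).2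

theorem gadgetRotation_nodup (x : X) : (gadgetRotation e x).Nodup := by
  simp [gadgetRotation]

theorem gadgetRotation_next {x : X} (h : (gadgetRotation e x).Nodup) (k : Fin 3)
    (hk : (e (k, x), e (k + 1, x)) ∈ gadgetRotation e x) :
    (gadgetRotation e x).next h _ hk = (e (k + 1, x), e (k + 2, x)) := by
  fin_cases k <;>
  · change List.next [_, _, _] _ hk = _
    simp [List.next, List.nextOr]

theorem eliminate_gadgetRotation {x : X} (hx : x ∉ s) (h : (gadgetRotation e x).Nodup) :
    eliminate (gadgetMatching e s) (gadgetRotation e x) h = gadgetMatching e (insert x s) := by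
  ext ⟨m, w⟩
  obtain ⟨⟨k, y⟩, rfl⟩ := e.surjective m
  rw [gadgetMatching_man, eliminate]
  simp only [Set.mem_union, Set.mem_ofPred_eq, gadgetMatching_man, mem_gadgetRotation]
  constructor
  · rintro (⟨h1, h2⟩ | ⟨a, ⟨j, rfl⟩, h1⟩)
    · have hyx : y = x → w ≠ e (k + 1, x) := by
        rintro rfl rfl
        exact h2 ⟨k, rfl⟩
      by_cases hyx' : y = x
      · subst hyx'
        simp [hx, hyx rfl] at h1
      · simpa [hyx'] using h1
    · rw [gadgetRotation_next] at h1
      obtain ⟨h1, h3⟩ := Prod.mk.inj h1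
      obtain ⟨rfl, rfl⟩ := Prod.mk.inj (e.injective h1)
      right
      exact ⟨Set.mem_insert _ _, h3⟩
  · rintro (⟨h1, rfl⟩ | ⟨h1, rfl⟩)
    · rw [Set.mem_insert_iff, not_or] at h1
      left
      exact ⟨.inl ⟨h1.2, rfl⟩, by
        rintro ⟨j, hj⟩
        exact h1.1 (Prod.mk.inj (e.injective (Prod.mk.inj hj).1)).2⟩
    · by_cases hyx : y = x
      · subst hyx
        right
        refine ⟨(e (k, y), e (k + 1, y)), ⟨k, rfl⟩, ?_⟩
        rw [gadgetRotation_next]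
      · left
        refine ⟨.inr ⟨by simpa [hyx] using h1, rfl⟩, ?_⟩
        rintro ⟨j, hj⟩
        exact hyx (Prod.mk.inj (e.injective (Prod.mk.inj hj).1)).2

end Matching

theorem Fin.add_one_add_one_of_three (k : Fin 3) : k + 1 + 1 = k + 2 := by revert k; decide

theorem Fin.add_one_add_two_of_three (k : Fin 3) : k + 1 + 2 = k := by revert k; decide

theorem Fin.add_two_add_one_of_three (k : Fin 3) : k + 2 + 1 = k := by revert k; decide

theorem Fin.add_two_add_two_of_three (k : Fin 3) : k + 2 + 2 = k + 1 := by revert k; decide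

theorem Fin.eq_of_add_two_eq_zero {k : Fin 3} : k + 2 = 0 → k = 1 := by revert k; decide

/-! ### Stable matchings correspond to down-sets. -/

namespace IsGadget

variable {n : ℕ} {X : Type u} [PartialOrder X] {P : Preferences n} {e : Fin 3 × X ≃ Fin n}
  {φ : Fin 3 → X → ℕ} {s : Set X}

theorem acceptable_of_mem (h : IsGadget P e φ) {m w : Fin n} (hm : w ∈ P.man m) :
    P.Acceptable m w :=
  ⟨hm, (h.consistent m w).1 hm⟩

theorem acceptable_first (h : IsGadget P e φ) (k : Fin 3) (x : X) :
    P.Acceptable (e (k, x)) (e (k + 1, x)) :=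
  h.acceptable_of_mem (h.man_own k x).mem

theorem acceptable_second (h : IsGadget P e φ) (k : Fin 3) (x : X) :
    P.Acceptable (e (k, x)) (e (k + 2, x)) := by
  refine h.acceptable_of_mem ((h.consistent _ _).2 ?_)
  have := (h.woman_own (k + 2) x).mem
  rwa [Fin.add_two_add_one_of_three] at this

theorem woman_own' (h : IsGadget P e φ) (k : Fin 3) (x : X) :
    Prefers (P.woman (e (k + 2, x))) (e (k, x)) (e (k + 1, x)) := by
  have := h.woman_own (k + 2) x
  rwa [Fin.add_two_add_one_of_three,
    Fin.add_two_add_two_of_three] at this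

/-- Harmless pairs do not occur in stable matchings, by descent along φ, once for each kind of
harmless pair. -/
theorem first_or_second_or_cover (h : IsGadget P e φ) {μ : Set (Fin n × Fin n)}
    (hμ : P.IsStable μ) {k j : Fin 3} {x y : X} (hmem : (e (k, x), e (j, y)) ∈ μ) :
    (y = x ∧ j = k + 1) ∨ (y = x ∧ j = k + 2) ∨ (k = 0 ∧ j = 0 ∧ y ⋖ x) := by
  -- The woman (j,y) would rather have man (j+2,y), whose first choice she is. He must have somebody
  -- still better, in a pair of the same kind whose potential is smaller.
  have key1 : ∀ N k x j y, φ (j + 2) y < N → (e (k, x), e (j, y)) ∈ μ →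
      ¬ Prefers (P.woman (e (j, y))) (e (j + 2, y)) (e (k, x)) := by
    intro N
    induction N with
    | zero => intro k x j y hN; omega
    | succ N ih =>
      intro k x j y hN hmem hp
      have hj := Fin.add_two_add_one_of_three j
      have hacc := h.acceptable_first (j + 2) y
      rw [hj] at hacc
      rcases hμ.cases hacc with h1 | ⟨w', h1, h2⟩ | ⟨m', h1, h2⟩
      · rw [hμ.1.woman_unique _ _ _ hmem h1] at hp
        exact hp.irrefl
      · obtain ⟨⟨i, z⟩, rfl⟩ := e.surjective w'
        have hown := h.man_own (j + 2) y
        rw [hj] at hown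
        rcases h.harmless (j + 2) y i z h2.mem with ⟨rfl, hi⟩ | ⟨rfl, hi⟩ | ⟨h3, rfl, h4⟩ |
          ⟨h3, h4⟩ | ⟨h3, h4⟩
        · rw [hj] at hi
          subst hi
          exact h2.irrefl
        · subst hi
          exact h2.asymm hown
        · have := (h.man_cover z y h4).1
          rw [h3, Fin.eq_of_add_two_eq_zero h3] at h2
          exact h2.asymm this
        · rw [hj] at h4
          have := h4 h2
          exact ih (j + 2) y i z (by omega) h1 h3
        · exact h2.asymm (hown.trans h3)
      · rw [hμ.1.woman_unique _ _ _ h1 hmem] at h2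
        exact hp.asymm h2
  -- The same descent with the sexes exchanged: man (k,x) is the first choice of woman (k+2,x), who
  -- must have somebody still better.
  have key2 : ∀ N k x j y, φ k x < N → (e (k, x), e (j, y)) ∈ μ →
      ¬ Prefers (P.man (e (k, x))) (e (k + 2, x)) (e (j, y)) := by
    intro N
    induction N with
    | zero => intro k x j y hN; omega
    | succ N ih =>
      intro k x j y hN hmem hp
      rcases hμ.cases (h.acceptable_second k x) with h1 | ⟨w', h1, h2⟩ | ⟨m', h1, h2⟩
      · rw [hμ.1.man_unique _ _ _ hmem h1] at hp
        exact hp.irrefl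
      · rw [hμ.1.man_unique _ _ _ h1 hmem] at h2
        exact hp.asymm h2
      · obtain ⟨⟨i, z⟩, rfl⟩ := e.surjective m'
        have hown := h.woman_own' k x
        rcases h.harmless i z (k + 2) x ((h.consistent _ _).2 h2.mem) with ⟨rfl, hi⟩ | ⟨rfl, hi⟩ |
          ⟨rfl, h3, h4⟩ | ⟨h3, h4⟩ | ⟨h3, h4⟩
        · obtain rfl : i = k + 1 := by
            clear * - hi; revert i k; decide
          exact h2.asymm hown
        · obtain rfl : i = k := by
            clear * - hi; revert i k; decide
          exact h2.irrefl
        · have := (h.woman_cover x z h4).1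
          rw [h3, Fin.eq_of_add_two_eq_zero h3] at h2
          exact h2.asymm this
        · rw [Fin.add_two_add_two_of_three] at h3
          exact h2.asymm (hown.trans h3)
        · rw [Fin.add_two_add_one_of_three] at h4
          exact ih i z (k + 2) x (lt_of_lt_of_le (h4 h2) (Nat.lt_succ_iff.1 hN)) h1 h3
  rcases h.harmless k x j y (hμ.1.acceptable _ _ hmem).1 with h1 | h1 | h1 | ⟨h1, h2⟩ | ⟨h1, h2⟩
  · exact .inl h1
  · exact .inr (.inl h1)
  · exact .inr (.inr h1)
  · exact absurd h1 (key1 _ _ _ _ _ (Nat.lt_succ_self _) hmem)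
  · exact absurd h1 (key2 _ _ _ _ _ (Nat.lt_succ_self _) hmem)

/-- If man (0,y) were matched to (0,x), his first choice (1,y) would have to hold her favourite
(2,y). Then (0,y), the first choice of (2,y), must have (1,y), since a covering partner is excluded
by induction from the top of the poset. Then (2,y), the first choice of (1,y), would need man (0,y),
who is taken. -/
theorem not_cover [Finite X] (h : IsGadget P e φ) {μ : Set (Fin n × Fin n)} (hμ : P.IsStable μ)
    {x y : X} (hxy : x ⋖ y) : (e (0, y), e (0, x)) ∉ μ := by
  induction y using WellFoundedGT.induction generalizing x with
  | ind y ih =>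
  intro hmem
  have noty : ∀ k, k ≠ 0 → (e (0, y), e (k, y)) ∉ μ := by
    intro k hk hk'
    have := hμ.1.man_unique _ _ _ hk' hmem
    exact hk (Prod.mk.inj (e.injective this)).1
  have h2 : (e (2, y), e (1, y)) ∈ μ := by
    rcases hμ.cases (h.acceptable_first 0 y) with h1 | ⟨w', h1, h2⟩ | ⟨m', h1, h2⟩
    · exact absurd h1 (noty 1 (by decide))
    · rw [hμ.1.man_unique _ _ _ h1 hmem] at h2
      exact absurd h2 (h.man_cover x y hxy).1.asymm
    · obtain ⟨⟨i, z⟩, rfl⟩ := e.surjective m'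
      rcases h.first_or_second_or_cover hμ h1 with ⟨rfl, hi⟩ | ⟨rfl, hi⟩ | ⟨_, hi, _⟩
      · obtain rfl : i = 0 := by clear * - hi; revert i; decide
        exact absurd h2 Prefers.irrefl
      · obtain rfl : i = 2 := by clear * - hi; revert i; decide
        exact h1
      · exact absurd hi (by decide)
  rcases hμ.cases (h.acceptable_first 2 y) with h1 | ⟨w', h1, h3⟩ | ⟨m', h1, h3⟩
  · have := hμ.1.man_unique _ _ _ h1 h2
    exact absurd (Prod.mk.inj (e.injective this)).1 (by decide)
  · rw [hμ.1.man_unique _ _ _ h1 h2] at h3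
    exact absurd h3 (h.man_own 2 y).asymm
  · obtain ⟨⟨i, z⟩, rfl⟩ := e.surjective m'
    rcases h.first_or_second_or_cover hμ h1 with ⟨rfl, hi⟩ | ⟨rfl, hi⟩ | ⟨rfl, _, hi⟩
    · obtain rfl : i = 2 := by clear * - hi; revert i; decide
      exact h3.irrefl
    · obtain rfl : i = 1 := by clear * - hi; revert i; decide
      rcases hμ.cases (h.acceptable_first 1 y) with h4 | ⟨w', h4, h5⟩ | ⟨m', h4, h5⟩
      · have := hμ.1.man_unique _ _ _ h1 h4
        exact absurd (Prod.mk.inj (e.injective this)).1 (by decide)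
      · rw [hμ.1.man_unique _ _ _ h4 h1] at h5
        exact h5.asymm (h.man_own 1 y)
      · obtain ⟨⟨i, z⟩, rfl⟩ := e.surjective m'
        rcases h.first_or_second_or_cover hμ h4 with ⟨rfl, hi⟩ | ⟨rfl, hi⟩ | ⟨_, hi, _⟩
        · obtain rfl : i = 1 := by clear * - hi; revert i; decide
          exact h5.irrefl
        · obtain rfl : i = 0 := by clear * - hi; revert i; decide
          exact noty 2 (by decide) h4
        · exact absurd hi (by decide)
    · exact ih z hi.lt hi h1

theorem first_or_second [Finite X] (h : IsGadget P e φ) {μ : Set (Fin n × Fin n)}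
    (hμ : P.IsStable μ) {k j : Fin 3} {x y : X} (hmem : (e (k, x), e (j, y)) ∈ μ) :
    y = x ∧ (j = k + 1 ∨ j = k + 2) := by
  rcases h.first_or_second_or_cover hμ hmem with ⟨rfl, hi⟩ | ⟨rfl, hi⟩ | ⟨rfl, rfl, hi⟩
  · exact ⟨rfl, .inl hi⟩
  · exact ⟨rfl, .inr hi⟩
  · exact absurd hmem (h.not_cover hμ hi)

theorem man_matched [Finite X] (h : IsGadget P e φ) {μ : Set (Fin n × Fin n)}
    (hμ : P.IsStable μ) (k : Fin 3) (x : X) :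
    (e (k, x), e (k + 1, x)) ∈ μ ∨ (e (k, x), e (k + 2, x)) ∈ μ := by
  rcases hμ.cases (h.acceptable_second k x) with h1 | ⟨w', h1, h2⟩ | ⟨m', h1, h2⟩
  · exact .inr h1
  · obtain ⟨⟨j, y⟩, rfl⟩ := e.surjective w'
    obtain ⟨rfl, rfl | rfl⟩ := h.first_or_second hμ h1
    exacts [.inl h1, .inr h1]
  · obtain ⟨⟨i, z⟩, rfl⟩ := e.surjective m'
    obtain ⟨rfl, hi | hi⟩ := h.first_or_second hμ h1
    · obtain rfl : i = k + 1 := by clear * - hi; revert i k; decide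
      exact absurd h2 (h.woman_own' k x).asymm
    · obtain rfl : i = k := by clear * - hi; revert i k; decide
      exact absurd h2 Prefers.irrefl

/-- The three men of a gadget share one state: if man k has woman k+1, she is not available as the
second choice of man k+2, so he has his first choice too. The set is closed under coverings because
the covering pair would block otherwise. -/
theorem eq_gadgetMatching [Finite X] (h : IsGadget P e φ) {μ : Set (Fin n × Fin n)}
    (hμ : P.IsStable μ) : ∃ s, CoverClosed s ∧ μ = gadgetMatching e s := by
  have step : ∀ k x, (e (k, x), e (k + 1, x)) ∈ μ → (e (k + 2, x), e (k + 2 + 1, x)) ∈ μ := by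
    intro k x hk
    refine (h.man_matched hμ (k + 2) x).resolve_right fun h2 => ?_
    rw [Fin.add_two_add_two_of_three] at h2
    have := hμ.1.woman_unique _ _ _ hk h2
    have := (Prod.mk.inj (e.injective this)).1
    clear * - this; revert k; decide
  have all : ∀ k x, (e (k, x), e (k + 1, x)) ∈ μ ↔ (e (0, x), e (1, x)) ∈ μ := by
    have h0 : ∀ x, (e (0, x), e (1, x)) ∈ μ → (e (2, x), e (0, x)) ∈ μ := fun x => step 0 x
    have h2 : ∀ x, (e (2, x), e (0, x)) ∈ μ → (e (1, x), e (2, x)) ∈ μ := fun x => step 2 x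
    have h1 : ∀ x, (e (1, x), e (2, x)) ∈ μ → (e (0, x), e (1, x)) ∈ μ := fun x => step 1 x
    intro k x
    fin_cases k
    · exact Iff.rfl
    · exact ⟨h1 x, fun h => h2 x (h0 x h)⟩
    · exact ⟨fun h => h1 x (h2 x h), h0 x⟩
  have hfs : ∀ k x, (e (k, x), e (k + 1, x)) ∈ μ → (e (k, x), e (k + 2, x)) ∉ μ := by
    intro k x hk hk'
    have := (Prod.mk.inj (e.injective (hμ.1.man_unique _ _ _ hk hk'))).1
    clear * - this; revert k; decide
  have hμs : μ = gadgetMatching e {x | (e (0, x), e (1, x)) ∉ μ} := by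
    ext ⟨m, w⟩
    obtain ⟨⟨k, x⟩, rfl⟩ := e.surjective m
    rw [gadgetMatching_man, Set.mem_ofPred_eq, not_not, ← all k x]
    constructor
    · obtain ⟨⟨j, y⟩, rfl⟩ := e.surjective w
      intro hm
      obtain ⟨rfl, rfl | rfl⟩ := h.first_or_second hμ hm
      · exact .inl ⟨hm, rfl⟩
      · exact .inr ⟨fun h' => hfs k y h' hm, rfl⟩
    · rintro (⟨h1, rfl⟩ | ⟨h1, rfl⟩)
      · exact h1
      · exact (h.man_matched hμ k x).resolve_left h1
  refine ⟨_, ?_, hμs⟩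
  intro x y hxy hy
  by_contra hx
  have hy0 := gadgetMatching_second e _ hy 0
  have hx2 := gadgetMatching_first e _ hx 2
  rw [← hμs] at hy0 hx2
  rcases hμ.cases (h.acceptable_of_mem (h.man_cover x y hxy).2.mem) with h1 | ⟨w', h1, h2⟩ |
    ⟨m', h1, h2⟩
  · exact h.not_cover hμ hxy h1
  · rw [hμ.1.man_unique _ _ _ h1 hy0] at h2
    exact h2.asymm (h.man_cover x y hxy).2
  · rw [hμ.1.woman_unique _ _ _ h1 hx2] at h2
    exact h2.asymm (h.woman_cover x y hxy).2

theorem gadgetMatching_isStable (h : IsGadget P e φ) (hs : CoverClosed s) :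
    P.IsStable (gadgetMatching e s) := by
  refine ⟨⟨?_, ?_, ?_⟩, ?_⟩
  · rintro m w ⟨k, x, ⟨h1, h2⟩ | ⟨h1, h2⟩⟩
    · obtain ⟨rfl, rfl⟩ := Prod.mk.inj h2
      exact h.acceptable_first k x
    · obtain ⟨rfl, rfl⟩ := Prod.mk.inj h2
      exact h.acceptable_second k x
  · intro m w w' h1 h2
    obtain ⟨⟨k, x⟩, rfl⟩ := e.surjective m
    rw [gadgetMatching_man] at h1 h2
    grind
  · intro m m' w h1 h2
    obtain ⟨⟨k, x⟩, rfl⟩ := e.surjective w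
    rw [gadgetMatching_woman] at h1 h2
    grind
  · rintro m w ⟨hacc, hm, hw⟩
    obtain ⟨⟨k, x⟩, rfl⟩ := e.surjective m
    obtain ⟨⟨j, y⟩, rfl⟩ := e.surjective w
    -- In a blocking pair both agents improve at least on their worse own partner, which rules out
    -- the harmless pairs.
    have hm1 : Prefers (P.man (e (k, x))) (e (j, y)) (e (k + 2, x)) := by
      by_cases hx : x ∈ s
      · exact hm _ (gadgetMatching_second e s hx k)
      · exact (hm _ (gadgetMatching_first e s hx k)).trans (h.man_own k x)
    have hw1 : Prefers (P.woman (e (j, y))) (e (k, x)) (e (j + 2, y)) := by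
      by_cases hy : y ∈ s
      · exact (hw _ ((gadgetMatching_woman e s).2 (.inr ⟨hy, rfl⟩))).trans (h.woman_own j y)
      · exact hw _ ((gadgetMatching_woman e s).2 (.inl ⟨hy, rfl⟩))
    rcases h.harmless k x j y hacc.1 with ⟨rfl, rfl⟩ | ⟨rfl, rfl⟩ | ⟨rfl, rfl, hyx⟩ | ⟨h1, -⟩ |
      ⟨h1, -⟩
    · rw [Fin.add_one_add_two_of_three] at hw1
      exact hw1.irrefl
    · exact hm1.irrefl
    · by_cases hx : x ∈ s
      · have hy := hs y x hyx hx
        exact (hw _ ((gadgetMatching_woman e s).2 (.inr ⟨hy, rfl⟩))).asymm (h.woman_cover y x hyx).1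
      · exact (hm _ (gadgetMatching_first e s hx 0)).asymm (h.man_cover y x hyx).1
    · exact hw1.asymm h1
    · exact hm1.asymm h1

end IsGadget

/-! ### Exposed rotations and the rotation poset. -/

namespace IsGadget

variable {n : ℕ} {X : Type u} [PartialOrder X] {I : SMInstance n} {e : Fin 3 × X ≃ Fin n}
  {φ : Fin 3 → X → ℕ} {s : Set X}

theorem coverClosed_empty : CoverClosed (∅ : Set X) := fun _ _ _ h => h

theorem eq_gadgetMatching_empty [Finite X] (h : IsGadget I.toPreferences e φ)
    {μ : Set (Fin n × Fin n)} (hμ : I.IsManOptimal μ) : μ = gadgetMatching e ∅ := by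
  obtain ⟨s, hs, rfl⟩ := h.eq_gadgetMatching hμ.1
  congr 1
  refine Set.eq_empty_of_forall_notMem fun x hx => ?_
  exact hμ.2 _ (h.gadgetMatching_isStable coverClosed_empty) _ _ _
    (gadgetMatching_second e s hx 0) (gadgetMatching_first e ∅ (Set.notMem_empty x) 0)
    (h.man_own 0 x)

theorem isManOptimal [Finite X] (h : IsGadget I.toPreferences e φ) :
    I.IsManOptimal (gadgetMatching e ∅) := by
  refine ⟨h.gadgetMatching_isStable coverClosed_empty, fun μ hμ m w w' h1 h2 => ?_⟩
  obtain ⟨s, hs, rfl⟩ := h.eq_gadgetMatching hμ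
  obtain ⟨⟨k, x⟩, rfl⟩ := e.surjective m
  rw [gadgetMatching_man] at h1 h2
  obtain ⟨-, rfl⟩ | ⟨h1, -⟩ := h1
  · obtain ⟨-, rfl⟩ | ⟨-, rfl⟩ := h2
    · exact Prefers.irrefl
    · exact (h.man_own k x).asymm
  · exact absurd h1 (Set.notMem_empty x)

theorem isExposed_gadgetRotation (h : IsGadget I.toPreferences e φ) {x : X} (hs : CoverClosed s)
    (hx : x ∉ s) (hxs : ∀ y, y ⋖ x → y ∈ s) :
    I.IsExposed (gadgetMatching e s) (gadgetRotation e x) := by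
  refine ⟨h.gadgetMatching_isStable hs, by simp [gadgetRotation], gadgetRotation_nodup e x, ?_⟩
  intro a ha
  obtain ⟨k, rfl⟩ := (mem_gadgetRotation e).1 ha
  refine ⟨gadgetMatching_first e s hx k, ?_⟩
  rw [gadgetRotation_next]
  refine ⟨h.man_own k x, h.woman_own' k x, ?_⟩
  rintro ⟨w, m', hm', h1, h2, h3⟩
  obtain ⟨⟨j, y⟩, rfl⟩ := e.surjective w
  rcases h.harmless k x j y h2.mem with ⟨rfl, rfl⟩ | ⟨rfl, rfl⟩ | ⟨rfl, rfl, hyx⟩ | ⟨h4, -⟩ |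
    ⟨h4, -⟩
  · exact h1.irrefl
  · exact h2.irrefl
  · rcases (gadgetMatching_woman e s).1 hm' with ⟨h4, -⟩ | ⟨-, rfl⟩
    · exact h4 (hxs y hyx)
    · exact h3.asymm (h.woman_cover y x hyx).1
  · rcases (gadgetMatching_woman e s).1 hm' with ⟨-, rfl⟩ | ⟨-, rfl⟩
    · exact h3.asymm h4
    · exact h3.asymm ((h.woman_own j y).trans h4)
  · exact h2.asymm h4

/-- The successor of a pair outside `s` belongs to the same gadget or to that of a covered element. -/
theorem successor_of_first (h : IsGadget I.toPreferences e φ) {k : Fin 3} {x : X} (hx : x ∉ s)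
    {b : Fin n × Fin n} (hb : b ∈ gadgetMatching e s)
    (hab : I.IsSuccessor (gadgetMatching e s) (e (k, x), e (k + 1, x)) b) :
    b = (e (k + 1, x), e (k + 2, x)) ∨ ∃ y, y ∉ s ∧ y ⋖ x ∧ b = (e (2, y), e (0, y)) := by
  obtain ⟨m', w⟩ := b
  obtain ⟨⟨j, y⟩, rfl⟩ := e.surjective w
  obtain ⟨h1, h2, h3⟩ := hab
  dsimp only at h1 h2 h3
  -- Woman (k+2,x) prefers man (k,x) to her partner (k+1,x), so the search for the successor stops
  -- at her at the latest.
  have h4 : ¬ Prefers (I.man (e (k, x))) (e (k + 2, x)) (e (j, y)) := by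
    intro h4
    refine h3 ⟨_, _, (gadgetMatching_woman e s).2 (.inl ⟨hx, rfl⟩), h.man_own k x, h4, ?_⟩
    rw [Fin.add_two_add_two_of_three]
    exact h.woman_own' k x
  have hacc : e (j, y) ∈ I.man (e (k, x)) := (I.consistent _ _).2 h2.mem
  rcases h.harmless k x j y hacc with ⟨rfl, rfl⟩ | ⟨rfl, rfl⟩ | ⟨rfl, rfl, hyx⟩ | ⟨h5, -⟩ |
    ⟨h5, -⟩
  · exact absurd h1 Prefers.irrefl
  · left
    rcases (gadgetMatching_woman e s).1 hb with ⟨-, rfl⟩ | ⟨h6, -⟩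
    · rw [Fin.add_two_add_two_of_three]
    · exact absurd h6 hx
  · right
    rcases (gadgetMatching_woman e s).1 hb with ⟨h6, rfl⟩ | ⟨-, rfl⟩
    · exact ⟨y, h6, hyx, rfl⟩
    · exact absurd h2 (h.woman_cover y x hyx).1.asymm
  · rcases (gadgetMatching_woman e s).1 hb with ⟨-, rfl⟩ | ⟨-, rfl⟩
    · exact absurd h2 h5.asymm
    · exact absurd h2 ((h.woman_own j y).trans h5).asymm
  · exact absurd h5 h4

/-- Woman (j+2,y) has her first choice (j,y) already. She can only want (k,x) more through a
harmless pair, and there φ increases. -/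
theorem successor_of_second (h : IsGadget I.toPreferences e φ) {k j : Fin 3} {x y : X}
    (hab : I.IsSuccessor (gadgetMatching e s) (e (k, x), e (k + 2, x)) (e (j, y), e (j + 2, y))) :
    φ k x < φ j y := by
  obtain ⟨h1, h2, -⟩ := hab
  dsimp only at h1 h2
  have hacc : e (j + 2, y) ∈ I.man (e (k, x)) := (I.consistent _ _).2 h2.mem
  rcases h.harmless k x (j + 2) y hacc with ⟨rfl, h3⟩ | ⟨rfl, h3⟩ | ⟨rfl, h3, hyx⟩ | ⟨h3, -⟩ |
    ⟨h3, h4⟩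
  · rw [h3] at h1
    exact absurd h1 (h.man_own k y).asymm
  · rw [h3] at h1
    exact absurd h1 Prefers.irrefl
  · rw [h3] at h1
    exact absurd h1 (h.man_cover y x hyx).2.asymm
  · rw [Fin.add_two_add_two_of_three] at h3
    exact absurd (h2.trans (h.woman_own' j y)) h3.asymm
  · rw [Fin.add_two_add_one_of_three] at h4
    exact h4 h2

/-- Successors stay in a gadget or move to a covered element while the men are happy. So a rotation
that meets unrotated gadgets stays in a minimal one of them; a rotation that meets none would
increase φ forever. -/
theorem exists_eq_gadgetRotation [Finite X] (h : IsGadget I.toPreferences e φ)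
    {ρ : Cycle (Fin n × Fin n)} (hρ : I.IsExposed (gadgetMatching e s) ρ) :
    ∃ x, x ∉ s ∧ (∀ y, y ⋖ x → y ∈ s) ∧ ρ = gadgetRotation e x := by
  obtain ⟨hst, hne, hnd, hsucc⟩ := hρ
  by_cases hfin : ∃ x k, x ∉ s ∧ (e (k, x), e (k + 1, x)) ∈ ρ
  · obtain ⟨x, ⟨⟨k, hx, hk⟩, hmin⟩⟩ := exists_minimal_of_wellFoundedLT _ hfin
    have next_eq : ∀ j (hj : (e (j, x), e (j + 1, x)) ∈ ρ),
        ρ.next hnd _ hj = (e (j + 1, x), e (j + 2, x)) := by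
      intro j hj
      have hmem := ρ.next_mem hnd _ hj
      rcases h.successor_of_first hx (hsucc _ hmem).1 (hsucc _ hj).2 with h1 | ⟨y, hy, hyx, h1⟩
      · exact h1
      · rw [h1] at hmem
        exact absurd (hmin ⟨2, hy, hmem⟩ hyx.le) hyx.lt.not_ge
    have mem_succ : ∀ j, (e (j, x), e (j + 1, x)) ∈ ρ → (e (j + 1, x), e (j + 1 + 1, x)) ∈ ρ := by
      intro j hj
      have := ρ.next_mem hnd _ hj
      rwa [next_eq j hj, ← Fin.add_one_add_one_of_three] at this
    have mem_all : (e (0, x), e (1, x)) ∈ ρ ∧ (e (1, x), e (2, x)) ∈ ρ ∧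
        (e (2, x), e (0, x)) ∈ ρ := by
      have h0 : (e (0, x), e (1, x)) ∈ ρ → (e (1, x), e (2, x)) ∈ ρ := mem_succ 0
      have h1 : (e (1, x), e (2, x)) ∈ ρ → (e (2, x), e (0, x)) ∈ ρ := mem_succ 1
      have h2 : (e (2, x), e (0, x)) ∈ ρ → (e (0, x), e (1, x)) ∈ ρ := mem_succ 2
      fin_cases k
      · exact ⟨hk, h0 hk, h1 (h0 hk)⟩
      · exact ⟨h2 (h1 hk), hk, h1 hk⟩
      · exact ⟨h2 hk, h0 (h2 hk), hk⟩
    obtain ⟨m0, m1, m2⟩ := mem_all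
    refine ⟨x, hx, fun y hyx => ?_, ?_⟩
    -- For y ⋖ x outside s, woman (0,y) still has her second choice and stands between (1,x) and
    -- (2,x) on the list of man (0,x); she would be reached before (2,x).
    · by_contra hy
      have h1 := (hsucc _ m0).2
      rw [show ρ.next hnd _ m0 = _ from next_eq 0 m0] at h1
      exact h1.2.2 ⟨_, _, gadgetMatching_first e s hy 2, (h.man_cover y x hyx).1,
        (h.man_cover y x hyx).2, (h.woman_cover y x hyx).2⟩
    · exact Cycle.eq_of_next_three hnd (by simp) (by simp) m0 m1 m2 (next_eq 0 m0) (next_eq 1 m1)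
        (next_eq 2 m2)
  · exfalso
    push Not at hfin
    have second : ∀ a ∈ ρ, ∃ k x, x ∈ s ∧ a = (e (k, x), e (k + 2, x)) := by
      intro a ha
      obtain ⟨k, x, ⟨h1, rfl⟩ | ⟨h1, rfl⟩⟩ := (hsucc a ha).1
      · exact absurd ha (hfin x k h1)
      · exact ⟨k, x, h1, rfl⟩
    have unbounded : ∀ N, ∃ k x, x ∈ s ∧ (e (k, x), e (k + 2, x)) ∈ ρ ∧ N ≤ φ k x := by
      intro N
      induction N with
      | zero =>
        obtain ⟨a, ha⟩ : ∃ a, a ∈ ρ := by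
          induction ρ using Cycle.induction_on with
          | nil => exact absurd rfl hne
          | cons a l _ => exact ⟨a, by simp⟩
        obtain ⟨k, x, hx, rfl⟩ := second a ha
        exact ⟨k, x, hx, ha, Nat.zero_le _⟩
      | succ N ih =>
        obtain ⟨k, x, hx, ha, hN⟩ := ih
        have hmem := ρ.next_mem hnd _ ha
        obtain ⟨j, y, hy, hb⟩ := second _ hmem
        have h1 := (hsucc _ ha).2
        rw [hb] at h1 hmem
        have := h.successor_of_second h1
        exact ⟨j, y, hy, hmem, by omega⟩
    obtain ⟨N, hN⟩ := (Set.finite_range fun a : Fin 3 × X => φ a.1 a.2).bddAbove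
    obtain ⟨k, x, -, -, h1⟩ := unbounded (N + 1)
    have := hN ⟨(k, x), rfl⟩
    dsimp only at this
    omega

/-- The matching alone determines which rotations lie on any elimination path to it. -/
theorem eliminationSeq [Finite X] (h : IsGadget I.toPreferences e φ)
    {l : List (Cycle (Fin n × Fin n))} {μ : Set (Fin n × Fin n)} (hl : I.EliminationSeq l μ) :
    ∃ s, CoverClosed s ∧ μ = gadgetMatching e s ∧ ∀ x, gadgetRotation e x ∈ l ↔ x ∈ s := by
  induction hl with
  | start μ hμ => exact ⟨∅, coverClosed_empty, h.eq_gadgetMatching_empty hμ, by simp⟩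
  | step l μ ρ hρ _ hexp ih =>
    obtain ⟨s, hs, rfl, hls⟩ := ih
    obtain ⟨x, hx, hxs, rfl⟩ := h.exists_eq_gadgetRotation hexp
    refine ⟨insert x s, ?_, eliminate_gadgetRotation e s hx hρ, fun y => ?_⟩
    · rintro y z hyz (rfl | hz)
      · exact .inr (hxs y hyz)
      · exact .inr (hs y z hyz hz)
    · rw [List.mem_cons, hls, (gadgetRotation_injective e).eq_iff, Set.mem_insert_iff]

/-- Removing a maximal element from a down-set leaves a down-set in which the rotation of this
element is exposed. -/
theorem exists_eliminationSeq [Finite X] (h : IsGadget I.toPreferences e φ) (hs : CoverClosed s) :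
    ∃ l, I.EliminationSeq l (gadgetMatching e s) := by
  obtain ⟨N, hN⟩ : ∃ N, s.ncard = N := ⟨_, rfl⟩
  induction N generalizing s with
  | zero =>
    rw [Set.ncard_eq_zero] at hN
    subst hN
    exact ⟨[], .start _ h.isManOptimal⟩
  | succ N ih =>
    have hne : s.Nonempty := Set.nonempty_of_ncard_ne_zero (by omega)
    obtain ⟨x, hx⟩ := s.toFinite.exists_maximal hne
    have hcl : CoverClosed (s \ {x}) := by
      rintro y z hyz ⟨hz, hzx⟩
      refine ⟨hs y z hyz hz, ?_⟩
      rintro rfl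
      exact hyz.lt.not_ge (hx.2 hz hyz.le)
    have hxs : x ∉ s \ {x} := fun h => h.2 rfl
    obtain ⟨l, hl⟩ := ih hcl (by rw [Set.ncard_sdiff_singleton_of_mem hx.1]; omega)
    have hexp := h.isExposed_gadgetRotation hcl hxs fun y hy => ⟨hs y x hy hx.1, hy.lt.ne⟩
    have := hl.step _ _ _ (gadgetRotation_nodup e x) hexp
    rw [eliminate_gadgetRotation e _ hxs, Set.insert_sdiff_singleton, Set.insert_eq_of_mem hx.1]
      at this
    exact ⟨_, this⟩

theorem gadgetRotation_mem_eliminated [Finite X] (h : IsGadget I.toPreferences e φ)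
    (hs : CoverClosed s) (x : X) :
    gadgetRotation e x ∈ I.eliminated (gadgetMatching e s) ↔ x ∈ s := by
  constructor
  · rintro ⟨l, hl, hx⟩
    obtain ⟨t, -, hst, hlt⟩ := h.eliminationSeq hl
    rw [gadgetMatching_injective e hst]
    exact (hlt x).1 hx
  · intro hx
    obtain ⟨l, hl⟩ := h.exists_eliminationSeq hs
    obtain ⟨t, -, hst, hlt⟩ := h.eliminationSeq hl
    refine ⟨l, hl, (hlt x).2 ?_⟩
    rwa [← gadgetMatching_injective e hst]

/-- Where the rotation of y is exposed, s contains all elements covered by y, hence all below y. For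
the converse, the test matching is that of `Set.Iio y`, the least down-set in which it is exposed.
-/
theorem realizes [Finite X] (h : IsGadget I.toPreferences e φ) : I.Realizes X := by
  have lt_closed : ∀ x : X, CoverClosed (Set.Iio x) := fun x y z hyz hz => hyz.lt.trans hz
  have exposed : ∀ x, I.IsExposed (gadgetMatching e (Set.Iio x)) (gadgetRotation e x) := fun x =>
    h.isExposed_gadgetRotation (lt_closed x) Set.self_notMem_Iio fun y hy => hy.lt
  refine ⟨Equiv.ofBijective (fun x => ⟨gadgetRotation e x, _, exposed x⟩) ⟨?_, ?_⟩, ?_⟩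
  · intro x y hxy
    exact gadgetRotation_injective e (Subtype.mk.inj hxy)
  · rintro ⟨ρ, μ, hρ⟩
    obtain ⟨s, hs, rfl⟩ := h.eq_gadgetMatching hρ.1
    obtain ⟨x, -, -, rfl⟩ := h.exists_eq_gadgetRotation hρ
    exact ⟨x, rfl⟩
  · intro x y
    change x < y ↔ I.Precedes (gadgetRotation e x) (gadgetRotation e y)
    constructor
    · intro hxy μ hμ
      obtain ⟨s, hs, rfl⟩ := h.eq_gadgetMatching hμ.1
      obtain ⟨z, -, hzs, hz⟩ := h.exists_eq_gadgetRotation hμ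
      obtain rfl := gadgetRotation_injective e hz
      rw [h.gadgetRotation_mem_eliminated hs]
      -- In a finite poset, every relation a < b factors through an element covered by b.
      have down : ∀ b, b ∈ s → ∀ a, a ≤ b → a ∈ s := by
        intro b
        induction b using WellFoundedLT.induction with
        | ind b ih =>
          intro hb a hab
          rcases hab.eq_or_lt with rfl | hab
          · exact hb
          · obtain ⟨c, hac, hcb⟩ := exists_le_covBy_of_lt hab
            exact ih c hcb.lt (hs c b hcb hb) a hac
      obtain ⟨c, hac, hcb⟩ := exists_le_covBy_of_lt hxy
      exact down c (hzs c hcb) x hac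
    · intro hp
      exact (h.gadgetRotation_mem_eliminated (lt_closed y) x).1 (hp _ (exposed y))

end IsGadget

theorem IsGadget.exists_instance {n : ℕ} {X : Type u} [PartialOrder X] [Finite X]
    {P : Preferences n} {e : Fin 3 × X ≃ Fin n} {φ : Fin 3 → X → ℕ} (h : IsGadget P e φ)
    (hm : ∀ m, (P.man m).Nodup) (hw : ∀ w, (P.woman w).Nodup) :
    ∃ I : SMInstance n, I.toPreferences = P ∧ I.Realizes X := by
  have hmm : ∀ μ, P.IsStable μ → ∀ m, ∃ w, (m, w) ∈ μ := by
    intro μ hμ m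
    obtain ⟨⟨k, x⟩, rfl⟩ := e.surjective m
    rcases h.man_matched hμ k x with h1 | h1 <;> exact ⟨_, h1⟩
  have hwm : ∀ μ, P.IsStable μ → ∀ w, ∃ m, (m, w) ∈ μ := by
    intro μ hμ w
    obtain ⟨⟨k, x⟩, rfl⟩ := e.surjective w
    obtain ⟨s, -, rfl⟩ := h.eq_gadgetMatching hμ
    by_cases hx : x ∈ s
    · exact ⟨_, (gadgetMatching_woman e s).2 (.inr ⟨hx, rfl⟩)⟩
    · exact ⟨_, (gadgetMatching_woman e s).2 (.inl ⟨hx, rfl⟩)⟩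
  exact ⟨⟨P, hm, hw, h.consistent, hmm, hwm⟩, rfl, IsGadget.realizes h⟩

/-! ### Lists of numbers -/

/-- The entries of `l` that are less than `n`, as elements of `Fin n`. -/
def toFinList (n : ℕ) (l : List ℕ) : List (Fin n) :=
  l.filterMap fun x => if h : x < n then some ⟨x, h⟩ else none

theorem mem_toFinList {n : ℕ} {l : List ℕ} {a : Fin n} : a ∈ toFinList n l ↔ (a : ℕ) ∈ l := by
  simp only [toFinList, List.mem_filterMap]
  constructor
  · rintro ⟨x, hx, h⟩
    split_ifs at h
    obtain rfl := Option.some.inj h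
    exact hx
  · intro h
    exact ⟨a, h, by simp⟩

theorem nodup_toFinList {n : ℕ} {l : List ℕ} (h : l.Nodup) : (toFinList n l).Nodup := by
  refine List.Nodup.filterMap ?_ h
  intro a a' b hb hb'
  simp only [Option.mem_def] at hb hb'
  split_ifs at hb hb'
  rw [← hb'] at hb
  simpa using hb

theorem map_toFinList {n : ℕ} {l : List ℕ} (h : ∀ x ∈ l, x < n) :
    (toFinList n l).map Fin.val = l := by
  induction l with
  | nil => rfl
  | cons x l ih =>
    have hx : x < n := h x (by simp)
    simpa [toFinList, hx] using ih fun y hy => h y (by simp [hy])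

theorem idxOf_toFinList {n : ℕ} {l : List ℕ} (h : ∀ x ∈ l, x < n) (a : Fin n) :
    (toFinList n l).idxOf a = l.idxOf (a : ℕ) := by
  induction l with
  | nil => rfl
  | cons x l ih =>
    have hx : x < n := h x (by simp)
    have := ih fun y hy => h y (by simp [hy])
    have e : toFinList n (x :: l) = ⟨x, hx⟩ :: toFinList n l := by simp [toFinList, hx]
    rw [e]
    by_cases hxa : x = a
    · subst hxa
      simp
    · rw [List.idxOf_cons_ne _ hxa, List.idxOf_cons_ne _ (by rwa [Ne, Fin.ext_iff]), this]

theorem idxOf_lt_idxOf_append {l l' : List ℕ} {a b : ℕ} (ha : a ∈ l) (hb : b ∉ l) :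
    (l ++ l').idxOf a < (l ++ l').idxOf b := by
  rw [List.idxOf_append_of_mem ha, List.idxOf_append_of_notMem hb]
  have := List.idxOf_lt_length_iff.2 ha
  omega

theorem idxOf_range' {s p x : ℕ} (h : s ≤ x) (h' : x < s + p) :
    (List.range' s p).idxOf x = x - s := by
  have hn : (List.range' s p).Nodup := List.nodup_range'
  have hl : x - s < (List.range' s p).length := by simp; omega
  have := hn.idxOf_getElem (x - s) hl
  rwa [List.getElem_range', show s + 1 * (x - s) = x by omega] at this

/-! ### Preference lists of the gadgets -/

/-- The number of the agent `k` of the gadget of vertex `i`, of `p` vertices. -/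
def agentNumber (p : ℕ) (k : Fin 3) (i : ℕ) : ℕ := i + p * k

/-- Row `i` of the lists without harmless pairs, where `adj` encodes the coverings. -/
def coreRow (p : ℕ) (adj : ℕ → List ℕ) (i : ℕ) : List ℕ :=
  -- The branches are the agents k = 0, 1, 2, as i + p * k is the number of agent k; own partners
  -- come first and last.
  if i < p then (p + i) :: (adj i ++ [2 * p + i])
  else if i < 2 * p then [p + i, i - p] else [i - 2 * p, i - p]

/-- Row `i` of the complete lists that contain those of `coreRow` in their order. -/
def fullRow (p i : ℕ) : List ℕ :=
  -- Block order 1, 0, 2 suits k = 0 and leaves room for coverings in block 0; order 2, 0, 1 serves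
  -- both k = 1 (2 before 0) and k = 2 (0 before 1).
  if i < p then List.range' p p ++ (List.range' 0 p ++ List.range' (2 * p) p)
  else List.range' (2 * p) p ++ (List.range' 0 p ++ List.range' p p)

/-- `l`, followed by the other numbers below `n`. -/
def fillRow (n : ℕ) (l : List ℕ) : List ℕ := l ++ (List.range n).filter (· ∉ l)

/-- Each row is a list without repetitions of numbers below `n`. -/
def ValidRows (n : ℕ) (row : ℕ → List ℕ) : Prop :=
  ∀ i < n, (row i).Nodup ∧ ∀ x ∈ row i, x < n

/-- The rows rank the agents of the own gadget, and those that belong to coverings, as required. -/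
structure OwnOrder (p : ℕ) (adj row : ℕ → List ℕ) : Prop where
  own : ∀ k, ∀ i < p, (row (agentNumber p k i)).idxOf (agentNumber p (k + 1) i) <
    (row (agentNumber p k i)).idxOf (agentNumber p (k + 2) i)
  cover : ∀ i < p, ∀ j ∈ adj i, (row i).idxOf (p + i) < (row i).idxOf j ∧
    (row i).idxOf j < (row i).idxOf (2 * p + i)

section Rows

variable {p : ℕ} {adj : ℕ → List ℕ}

theorem agentNumber_zero (p i : ℕ) : agentNumber p 0 i = i := by simp [agentNumber]

theorem agentNumber_one (p i : ℕ) : agentNumber p 1 i = p + i := by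
  simp [agentNumber, Nat.add_comm]

theorem agentNumber_two (p i : ℕ) : agentNumber p 2 i = 2 * p + i := by
  simp [agentNumber, Nat.add_comm, Nat.mul_comm]

theorem agentNumber_lt {k : Fin 3} {i : ℕ} (hi : i < p) : agentNumber p k i < 3 * p := by
  fin_cases k <;> simp [agentNumber] <;> omega

theorem exists_agentNumber {x : ℕ} (hx : x < 3 * p) : ∃ k, ∃ i < p, x = agentNumber p k i := by
  by_cases h1 : x < p
  · exact ⟨0, x, h1, by simp [agentNumber]⟩
  · by_cases h2 : x < 2 * p
    · exact ⟨1, x - p, by omega, by simp [agentNumber]; omega⟩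
    · exact ⟨2, x - 2 * p, by omega, by simp [agentNumber]; omega⟩

theorem mem_coreRow (hadj : ∀ i < p, ∀ x ∈ adj i, x < p) {i i' : ℕ} (hi : i < p) (hi' : i' < p)
    (k j : Fin 3) : agentNumber p j i' ∈ coreRow p adj (agentNumber p k i) ↔
      (i' = i ∧ j = k + 1) ∨ (i' = i ∧ j = k + 2) ∨ (k = 0 ∧ j = 0 ∧ i' ∈ adj i) := by
  have h1 : ∀ x, p ≤ x → x ∉ adj i := fun x hx hx' => absurd (hadj i hi x hx') (by omega)
  have h2 : i' + p ∉ adj i := h1 _ (by omega)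
  have h3 : i' + p * 2 ∉ adj i := h1 _ (by omega)
  fin_cases k <;> fin_cases j <;> simp [agentNumber, coreRow, hi, h2, h3] <;> grind

theorem validRows_coreRow (hadj : ∀ i < p, ∀ x ∈ adj i, x < p) (hn : ∀ i < p, (adj i).Nodup) :
    ValidRows (3 * p) (coreRow p adj) := by
  intro i hi
  unfold coreRow
  split_ifs with h1 h2
  · have h3 : ∀ x, p ≤ x → x ∉ adj i := fun x hx hx' => absurd (hadj i h1 x hx') (by omega)
    constructor
    · rw [List.nodup_cons, List.nodup_append]
      refine ⟨?_, hn i h1, by simp, ?_⟩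
      · simp [h3 (p + i) (by omega)]
        omega
      · intro a ha b hb
        have := hadj i h1 a ha
        simp at hb
        omega
    · intro x hx
      simp only [List.mem_cons, List.mem_append, List.not_mem_nil, or_false] at hx
      rcases hx with rfl | hx | rfl
      · omega
      · have := hadj i h1 x hx
        omega
      · omega
  · simp
    omega
  · simp
    omega

theorem ownOrder_coreRow (hadj : ∀ i < p, ∀ x ∈ adj i, x < p) :
    OwnOrder p adj (coreRow p adj) := by
  have h1 : ∀ i < p, ∀ x, p ≤ x → x ∉ adj i :=
    fun i hi x hx hx' => absurd (hadj i hi x hx') (by omega)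
  constructor
  · intro k i hi
    fin_cases k
    · change (coreRow p adj (agentNumber p 0 i)).idxOf (agentNumber p 1 i) <
        (coreRow p adj (agentNumber p 0 i)).idxOf (agentNumber p 2 i)
      rw [agentNumber_zero, agentNumber_one, agentNumber_two, coreRow, if_pos hi,
        ← List.singleton_append]
      exact idxOf_lt_idxOf_append (by simp) (by simp; omega)
    · simp [coreRow, agentNumber]
      grind
    · simp [coreRow, agentNumber]
      grind
  · intro i hi j hj
    have hjp := hadj i hi j hj
    rw [coreRow, if_pos hi, ← List.singleton_append, ← List.append_assoc]
    constructor
    · rw [List.append_assoc]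
      exact idxOf_lt_idxOf_append (by simp) (by simp; omega)
    · exact idxOf_lt_idxOf_append (by simp [hj]) (by simp [h1 i hi (2 * p + i) (by omega)]; omega)

/-- The position of agent `(j, y)` in the complete list of an agent `(k, x)`. -/
def fullPosition (p : ℕ) (k j : Fin 3) (y : ℕ) : ℕ :=
  if k = 0 then (if j = 1 then y else if j = 0 then p + y else 2 * p + y)
  else (if j = 2 then y else if j = 0 then p + y else 2 * p + y)

theorem idxOf_three_ranges {a b c x : ℕ} :
    (List.range' a p ++ (List.range' b p ++ List.range' c p)).idxOf x =
      if a ≤ x ∧ x < a + p then x - a else if b ≤ x ∧ x < b + p then p + (x - b)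
      else if c ≤ x ∧ x < c + p then 2 * p + (x - c) else 3 * p := by
  simp only [List.idxOf_append, List.mem_range'_1, List.length_range']
  split_ifs with h1 h2 h3
  · exact idxOf_range' h1.1 h1.2
  · rw [idxOf_range' h2.1 h2.2]
    omega
  · rw [idxOf_range' h3.1 h3.2]
    omega
  · rw [List.idxOf_of_notMem (by simpa using h3)]
    simp
    omega

theorem idxOf_fullRow {i y : ℕ} (hi : i < p) (hy : y < p) (k j : Fin 3) :
    (fullRow p (agentNumber p k i)).idxOf (agentNumber p j y) = fullPosition p k j y := by
  unfold fullRow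
  simp only [apply_ite (List.idxOf (agentNumber p j y)), idxOf_three_ranges]
  fin_cases k <;> fin_cases j <;> simp [agentNumber, fullPosition, hi] <;> grind

theorem mem_fullRow {i x : ℕ} : x ∈ fullRow p i ↔ x < 3 * p := by
  unfold fullRow
  split_ifs <;> simp <;> omega

theorem nodup_fullRow (i : ℕ) : (fullRow p i).Nodup := by
  unfold fullRow
  split_ifs <;>
  · refine List.Nodup.append List.nodup_range' (List.Nodup.append List.nodup_range'
      List.nodup_range' ?_) ?_ <;>
    · intro x hx hx'
      simp at hx hx'
      omega

theorem validRows_fullRow : ValidRows (3 * p) (fullRow p) :=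
  fun i _ => ⟨nodup_fullRow i, fun _ hx => mem_fullRow.1 hx⟩

theorem ownOrder_fullRow (hadj : ∀ i < p, ∀ x ∈ adj i, x < p) : OwnOrder p adj (fullRow p) := by
  constructor
  · intro k i hi
    rw [idxOf_fullRow hi hi, idxOf_fullRow hi hi]
    fin_cases k <;> simp [fullPosition] <;> omega
  · intro i hi j hj
    have hjp := hadj i hi j hj
    have h := fun (y : ℕ) (hy : y < p) (j : Fin 3) => idxOf_fullRow (p := p) hi hy 0 j
    have h0 := h j hjp 0
    have h1 := h i hi 1
    have h2 := h i hi 2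
    simp only [agentNumber, fullPosition] at h0 h1 h2
    simp [Nat.add_comm _ p, Nat.mul_comm p 2, Nat.add_comm _ (2 * p)] at h0 h1 h2
    rw [h0, h1, h2]
    omega

/-- Blocks 1 and 2 come first in the lists of the agents whose first choices they contain, and block
0 is in the middle of both lists. So (j,y) is placed at least as early by (j+2,y), whose first
choice it is, as by (k,x). -/
theorem fullPosition_lt {x y : ℕ} (hx : x < p) {k j : Fin 3}
    (h : fullPosition p k j y < fullPosition p k (k + 1) x) :
    fullPosition p (j + 2) (j + 2 + 1) y < fullPosition p k (k + 1) x := by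
  revert h
  fin_cases k <;> fin_cases j <;> simp [fullPosition] <;> omega

theorem mem_fillRow {n x : ℕ} {l : List ℕ} (hl : ∀ x ∈ l, x < n) : x ∈ fillRow n l ↔ x < n := by
  simp only [fillRow, List.mem_append, List.mem_filter, List.mem_range, decide_eq_true_eq]
  by_cases hx : x ∈ l
  · simp [hx, hl x hx]
  · simp [hx]

theorem validRows_fillRow {n : ℕ} {row : ℕ → List ℕ} (h : ValidRows n row) :
    ValidRows n fun i => fillRow n (row i) := by
  intro i hi
  refine ⟨?_, fun x hx => (mem_fillRow (h i hi).2).1 hx⟩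
  refine List.Nodup.append (h i hi).1 (List.nodup_range.filter _) ?_
  intro x hx hx'
  simp [hx] at hx'

theorem idxOf_fillRow_lt {n : ℕ} {l : List ℕ} {a b : ℕ} (h : l.idxOf a < l.idxOf b) :
    (fillRow n l).idxOf a < (fillRow n l).idxOf b := by
  have ha : a ∈ l := List.idxOf_lt_length_iff.1 (lt_of_lt_of_le h List.idxOf_le_length)
  by_cases hb : b ∈ l
  · rwa [fillRow, List.idxOf_append_of_mem ha, List.idxOf_append_of_mem hb]
  · exact idxOf_lt_idxOf_append ha hb

theorem OwnOrder.fillRow {n : ℕ} {row : ℕ → List ℕ} (h : OwnOrder p adj row) :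
    OwnOrder p adj fun i => fillRow n (row i) :=
  ⟨fun k i hi => idxOf_fillRow_lt (h.own k i hi), fun i hi j hj =>
    ⟨idxOf_fillRow_lt (h.cover i hi j hj).1, idxOf_fillRow_lt (h.cover i hi j hj).2⟩⟩

/-- Compared block by block; it is here that the adjacency lists must be in increasing order. -/
theorem coreRow_sublist {n : ℕ} (hadj : ∀ i < p, List.Sublist (adj i) (List.range' 0 p)) {i : ℕ}
    (hi : i < 3 * p) :
    List.Sublist (toFinList n (coreRow p adj i)) (toFinList n (fullRow p i)) := by
  refine List.Sublist.filterMap _ ?_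
  unfold coreRow fullRow
  split_ifs with h1 h2
  · rw [← List.singleton_append]
    refine List.Sublist.append ?_ (List.Sublist.append (hadj i h1) ?_) <;> simp [h1]
  · rw [show [p + i, i - p] = [p + i] ++ ([i - p] ++ []) from rfl]
    refine List.Sublist.append ?_ (List.Sublist.append ?_ (List.nil_sublist _)) <;> simp <;> omega
  · rw [show [i - 2 * p, i - p] = [] ++ ([i - 2 * p] ++ [i - p]) from rfl]
    refine List.Sublist.append (List.nil_sublist _) (List.Sublist.append ?_ ?_) <;> simp <;> omega

end Rows

/-- The preferences that are given by rows of numbers. -/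
def rowPreferences (n : ℕ) (rowM rowW : ℕ → List ℕ) : Preferences n :=
  ⟨fun m => toFinList n (rowM m), fun w => toFinList n (rowW w)⟩

/-- The edges of a digraph as a list of pairs of numbers. -/
def edgeList {p q : ℕ} (E : Fin q → Fin p × Fin p) : List (ℕ × ℕ) :=
  List.ofFn fun k => (((E k).1 : ℕ), ((E k).2 : ℕ))

/-- The tails of the edges to `i`, in increasing order. -/
def predRow (p : ℕ) (l : List (ℕ × ℕ)) (i : ℕ) : List ℕ :=
  (List.range p).filter fun j => (j, i) ∈ l

/-- The heads of the edges from `i`, in increasing order. -/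
def succRow (p : ℕ) (l : List (ℕ × ℕ)) (i : ℕ) : List ℕ :=
  (List.range p).filter fun j => (i, j) ∈ l

/-- The numbering of the agents. -/
def agentEquiv {p : ℕ} {X : Type u} (v : Fin p ≃ X) : Fin 3 × X ≃ Fin (3 * p) :=
  (Equiv.prodCongr (Equiv.refl _) v.symm).trans finProdFinEquiv

theorem agentEquiv_val {p : ℕ} {X : Type u} (v : Fin p ≃ X) (k : Fin 3) (x : X) :
    (agentEquiv v (k, x) : ℕ) = agentNumber p k (v.symm x) := by
  simp [agentEquiv, agentNumber]

/-! ### The three instances. -/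

section

variable {X : Type u} [PartialOrder X] {p q : ℕ} {v : Fin p ≃ X} {E : Fin q → Fin p × Fin p}
  {rowM rowW : ℕ → List ℕ}

theorem predRow_lt (l : List (ℕ × ℕ)) : ∀ i < p, ∀ x ∈ predRow p l i, x < p := by
  intro i _ x hx
  simpa using List.mem_of_mem_filter hx

theorem succRow_lt (l : List (ℕ × ℕ)) : ∀ i < p, ∀ x ∈ succRow p l i, x < p := by
  intro i _ x hx
  simpa using List.mem_of_mem_filter hx

theorem predRow_nodup (l : List (ℕ × ℕ)) : ∀ i < p, (predRow p l i).Nodup :=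
  fun _ _ => List.nodup_range.filter _

theorem succRow_nodup (l : List (ℕ × ℕ)) : ∀ i < p, (succRow p l i).Nodup :=
  fun _ _ => List.nodup_range.filter _

theorem mem_predRow_iff_mem_succRow {l : List (ℕ × ℕ)} {i j : ℕ} (hi : i < p) (hj : j < p) :
    j ∈ predRow p l i ↔ i ∈ succRow p l j := by
  simp [predRow, succRow, hi, hj]

theorem IsHasseDiagram.covBy_iff (h : IsHasseDiagram v E) (x y : X) :
    x ⋖ y ↔ (v.symm x : ℕ) ∈ predRow p (edgeList E) (v.symm y) := by
  have := h.2 (v.symm x) (v.symm y)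
  rw [Equiv.apply_symm_apply, Equiv.apply_symm_apply] at this
  rw [← this]
  simp [predRow, edgeList, Prod.ext_iff, Fin.ext_iff, List.mem_ofFn]

/-- Reduces the gadget conditions to inequalities between positions in lists of numbers. -/
theorem isGadget_rowPreferences (h : IsHasseDiagram v E) (hM : ValidRows (3 * p) rowM)
    (hW : ValidRows (3 * p) rowW) (oM : OwnOrder p (predRow p (edgeList E)) rowM)
    (oW : OwnOrder p (succRow p (edgeList E)) rowW)
    (hc : ∀ m < 3 * p, ∀ w < 3 * p, w ∈ rowM m ↔ m ∈ rowW w) (φ : Fin 3 → ℕ → ℕ)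
    (hh : ∀ k j, ∀ i < p, ∀ i' < p, agentNumber p j i' ∈ rowM (agentNumber p k i) →
      agentNumber p j i' ∈ coreRow p (predRow p (edgeList E)) (agentNumber p k i) ∨
      ((rowW (agentNumber p j i')).idxOf (agentNumber p (j + 2) i') <
          (rowW (agentNumber p j i')).idxOf (agentNumber p k i) ∧
        ((rowM (agentNumber p k i)).idxOf (agentNumber p j i') <
          (rowM (agentNumber p k i)).idxOf (agentNumber p (k + 1) i) → φ (j + 2) i' < φ k i)) ∨
      ((rowM (agentNumber p k i)).idxOf (agentNumber p (k + 2) i) <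
          (rowM (agentNumber p k i)).idxOf (agentNumber p j i') ∧
        ((rowW (agentNumber p j i')).idxOf (agentNumber p k i) <
          (rowW (agentNumber p j i')).idxOf (agentNumber p (j + 1) i') → φ k i < φ (j + 1) i'))) :
    IsGadget (rowPreferences (3 * p) rowM rowW) (agentEquiv v) fun k x => φ k (v.symm x) := by
  have pM : ∀ m a b, Prefers ((rowPreferences (3 * p) rowM rowW).man m) a b ↔
      (rowM m).idxOf (a : ℕ) < (rowM m).idxOf (b : ℕ) := by
    intro m a b
    rw [Prefers, rowPreferences, idxOf_toFinList (hM m m.2).2, idxOf_toFinList (hM m m.2).2]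
  have pW : ∀ w a b, Prefers ((rowPreferences (3 * p) rowM rowW).woman w) a b ↔
      (rowW w).idxOf (a : ℕ) < (rowW w).idxOf (b : ℕ) := by
    intro m a b
    rw [Prefers, rowPreferences, idxOf_toFinList (hW m m.2).2, idxOf_toFinList (hW m m.2).2]
  constructor
  · intro m w
    rw [rowPreferences, mem_toFinList, mem_toFinList]
    exact hc m m.2 w w.2
  · intro k x
    rw [pM, agentEquiv_val, agentEquiv_val, agentEquiv_val]
    exact oM.own k _ (v.symm x).2
  · intro k x
    rw [pW, agentEquiv_val, agentEquiv_val, agentEquiv_val]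
    exact oW.own k _ (v.symm x).2
  · intro x y hxy
    simp only [pM, agentEquiv_val, agentNumber_zero, agentNumber_one, agentNumber_two]
    exact oM.cover _ (v.symm y).2 _ ((h.covBy_iff x y).1 hxy)
  · intro x y hxy
    simp only [pW, agentEquiv_val, agentNumber_zero, agentNumber_one, agentNumber_two]
    exact oW.cover _ (v.symm x).2 _ ((mem_predRow_iff_mem_succRow (v.symm y).2 (v.symm x).2).1
      ((h.covBy_iff x y).1 hxy))
  · intro k x j y hmem
    rw [rowPreferences, mem_toFinList, agentEquiv_val, agentEquiv_val] at hmem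
    simp only [pM, pW, agentEquiv_val]
    rcases hh k j _ (v.symm x).2 _ (v.symm y).2 hmem with h1 | h1
    · rw [mem_coreRow (predRow_lt _) (v.symm x).2 (v.symm y).2, Fin.val_inj, v.symm.injective.eq_iff,
        ← h.covBy_iff] at h1
      tauto
    · tauto

theorem exists_instance_of_rows {φ : Fin 3 → X → ℕ} (hM : ValidRows (3 * p) rowM)
    (hW : ValidRows (3 * p) rowW)
    (h : IsGadget (rowPreferences (3 * p) rowM rowW) (agentEquiv v) φ) :
    ∃ I : SMInstance (3 * p), I.toPreferences = rowPreferences (3 * p) rowM rowW ∧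
      I.Realizes X := by
  have : Finite X := Finite.of_equiv _ v
  exact h.exists_instance (fun m => nodup_toFinList (hM m m.2).1)
    fun w => nodup_toFinList (hW w w.2).1

theorem mem_coreRow_comm {l : List (ℕ × ℕ)} {m w : ℕ} (hm : m < 3 * p) (hw : w < 3 * p) :
    w ∈ coreRow p (predRow p l) m ↔ m ∈ coreRow p (succRow p l) w := by
  obtain ⟨k, i, hi, rfl⟩ := exists_agentNumber hm
  obtain ⟨j, i', hi', rfl⟩ := exists_agentNumber hw
  rw [mem_coreRow (predRow_lt l) hi hi', mem_coreRow (succRow_lt l) hi' hi,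
    mem_predRow_iff_mem_succRow hi hi']
  have h1 : j = k + 1 ↔ k = j + 2 := by clear * -; revert j k; decide
  have h2 : j = k + 2 ↔ k = j + 1 := by clear * -; revert j k; decide
  rw [h1, h2]
  tauto

/-- The instance with incomplete lists. -/
theorem exists_core_instance (h : IsHasseDiagram v E) :
    ∃ I : SMInstance (3 * p), I.toPreferences = rowPreferences (3 * p)
      (coreRow p (predRow p (edgeList E))) (coreRow p (succRow p (edgeList E))) ∧
      I.Realizes X := by
  have hM := validRows_coreRow (predRow_lt (p := p) (edgeList E)) (predRow_nodup _)
  have hW := validRows_coreRow (succRow_lt (p := p) (edgeList E)) (succRow_nodup _)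
  exact exists_instance_of_rows hM hW (isGadget_rowPreferences h hM hW
    (ownOrder_coreRow (predRow_lt _)) (ownOrder_coreRow (succRow_lt _))
    -- There are no harmless pairs here, so any potential will do.
    (fun m hm w hw => mem_coreRow_comm hm hw) (fun _ _ => 0) fun _ _ _ _ _ _ hmem => .inl hmem)

theorem idxOf_fillRow_lt_of_notMem {n a b : ℕ} {l : List ℕ} (ha : a ∈ l) (hb : b ∉ l) :
    (fillRow n l).idxOf a < (fillRow n l).idxOf b :=
  idxOf_lt_idxOf_append ha hb

/-- The instance with at most two lists of the men. -/
theorem exists_men_instance (h : IsHasseDiagram v E) :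
    ∃ I : SMInstance (3 * p), I.toPreferences = rowPreferences (3 * p)
      (fullRow p) (fun i => fillRow (3 * p) (coreRow p (succRow p (edgeList E)) i)) ∧
      I.Realizes X := by
  have hW0 := validRows_coreRow (succRow_lt (p := p) (edgeList E)) (succRow_nodup _)
  have hW := validRows_fillRow hW0
  refine exists_instance_of_rows validRows_fullRow hW (isGadget_rowPreferences h validRows_fullRow hW
    (ownOrder_fullRow (predRow_lt _)) (ownOrder_coreRow (succRow_lt _)).fillRow ?_
    -- The potential of a man is the position of his first choice on his list.
    (fun k i => fullPosition p k (k + 1) i) ?_)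
  · intro m hm w hw
    rw [mem_fullRow, mem_fillRow (hW0 w hw).2]
    exact iff_of_true hw hm
  · intro k j i hi i' hi' _
    by_cases hmem : agentNumber p j i' ∈ coreRow p (predRow p (edgeList E)) (agentNumber p k i)
    · exact .inl hmem
    · refine .inr (.inl ⟨idxOf_fillRow_lt_of_notMem ?_ ?_, ?_⟩)
      · exact (mem_coreRow (succRow_lt _) hi' hi' _ _).2 (.inr (.inl ⟨rfl, rfl⟩))
      · rwa [← mem_coreRow_comm (agentNumber_lt hi) (agentNumber_lt hi')]
      · rw [idxOf_fullRow hi hi', idxOf_fullRow hi hi]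
        exact fullPosition_lt hi

/-- The instance with at most two lists of the women. -/
theorem exists_women_instance (h : IsHasseDiagram v E) :
    ∃ I : SMInstance (3 * p), I.toPreferences = rowPreferences (3 * p)
      (fun i => fillRow (3 * p) (coreRow p (predRow p (edgeList E)) i)) (fullRow p) ∧
      I.Realizes X := by
  have hM0 := validRows_coreRow (predRow_lt (p := p) (edgeList E)) (predRow_nodup _)
  have hM := validRows_fillRow hM0
  refine exists_instance_of_rows hM validRows_fullRow (isGadget_rowPreferences h hM validRows_fullRow
    (ownOrder_coreRow (predRow_lt _)).fillRow (ownOrder_fullRow (succRow_lt _)) ?_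
    -- The potential of man (k,i) is his position on the list of woman (k+2,i), whose first choice
    -- he is.
    (fun k i => fullPosition p (k + 2) (k + 2 + 1) i) ?_)
  · intro m hm w hw
    rw [mem_fullRow, mem_fillRow (hM0 m hm).2]
    exact iff_of_true hw hm
  · intro k j i hi i' hi' _
    by_cases hmem : agentNumber p j i' ∈ coreRow p (predRow p (edgeList E)) (agentNumber p k i)
    · exact .inl hmem
    · refine .inr (.inr ⟨idxOf_fillRow_lt_of_notMem ?_ hmem, ?_⟩)
      · exact (mem_coreRow (predRow_lt _) hi hi _ _).2 (.inr (.inl ⟨rfl, rfl⟩))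
      · rw [idxOf_fullRow hi' hi, idxOf_fullRow hi' hi', Fin.add_one_add_two_of_three]
        exact fullPosition_lt hi'

theorem isCompleteList_toFinList {l : List ℕ} (h : l.Nodup) (h' : ∀ x, x ∈ l ↔ x < 3 * p) :
    IsCompleteList (toFinList (3 * p) l) :=
  ⟨nodup_toFinList h, fun a => mem_toFinList.2 ((h' a).2 a.2)⟩

theorem isCompleteList_fullRow (i : ℕ) : IsCompleteList (toFinList (3 * p) (fullRow p i)) :=
  isCompleteList_toFinList (nodup_fullRow i) fun _ => mem_fullRow

theorem isCompleteList_fillRow {row : ℕ → List ℕ} (h : ValidRows (3 * p) row) {i : ℕ}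
    (hi : i < 3 * p) : IsCompleteList (toFinList (3 * p) (fillRow (3 * p) (row i))) :=
  isCompleteList_toFinList (validRows_fillRow h i hi).1 fun _ => mem_fillRow (h i hi).2

theorem fullRow_eq_or (i : ℕ) : fullRow p i = fullRow p 0 ∨ fullRow p i = fullRow p p := by
  unfold fullRow
  by_cases h : i < p
  · simp [h, Nat.zero_lt_of_lt h]
  · simp [h]

theorem sublistsOfTwo_coreRow {adj : ℕ → List ℕ} {P : ℕ → ℕ → Bool}
    (hadj : ∀ i, adj i = (List.range p).filter (P i)) :
    SublistsOfTwo fun i : Fin (3 * p) => toFinList (3 * p) (coreRow p adj i) := by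
  refine ⟨_, _, isCompleteList_fullRow 0, isCompleteList_fullRow p, fun i => ?_⟩
  have := coreRow_sublist (n := 3 * p) (adj := adj) (p := p) (fun i _ => by
    rw [hadj, List.range_eq_range']
    exact List.filter_sublist) i.2
  rcases fullRow_eq_or (p := p) i with h | h
  · exact .inl (h ▸ this)
  · exact .inr (h ▸ this)

theorem inGroups_fullRow : InGroups 2 fun i : Fin (3 * p) => toFinList (3 * p) (fullRow p i) := by
  refine ⟨fun i => if (i : ℕ) < p then 0 else 1, ?_, ?_⟩
  · refine (Set.encard_le_encard (t := {0, 1}) ?_).trans (by rw [Set.encard_pair (by decide)])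
    rintro _ ⟨i, rfl⟩
    dsimp only
    split_ifs <;> simp
  · intro i j hij
    have : (i : ℕ) < p ↔ (j : ℕ) < p := by
      by_contra h
      dsimp only at hij
      split_ifs at hij <;> tauto
    simp only [fullRow, this]

theorem inGroups_top {n : ℕ} (pref : Fin n → List (Fin n)) : InGroups ⊤ pref :=
  ⟨fun i => i, le_top, fun i j h => by rw [Fin.ext h]⟩

end

/-! ### Total correctness of programs -/

/-- The array `A` holds the list `f i` in row `i`, preceded by its length. -/
def HoldsRows (A : ℕ → ℕ → ℕ) (f : ℕ → List ℕ) : Prop :=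
  ∀ i, A i 0 = (f i).length ∧ ∀ k, ∀ hk : k < (f i).length, A i (k + 1) = (f i)[k]

/-- An abstract view of machine states: registers, the lists in the rows of the arrays `1`, `2` and
`3`, and the array `4`. -/
structure Config where
  reg : ℕ → ℕ
  rows : ℕ → ℕ → List ℕ
  mark : ℕ → ℕ → ℕ

namespace Config

/-- Assign a value to a register. -/
def set (σ : Config) (x k : ℕ) : Config :=
  { σ with reg := Function.update σ.reg x k }

/-- Replace a list. -/
def setRow (σ : Config) (a i : ℕ) (l : List ℕ) : Config :=
  { σ with rows := Function.update σ.rows a (Function.update (σ.rows a) i l) }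

/-- Append a value to a list. -/
def push (σ : Config) (a i x : ℕ) : Config :=
  σ.setRow a i (σ.rows a i ++ [x])

/-- Assign a value to a cell of the array `4`. -/
def setMark (σ : Config) (i j k : ℕ) : Config :=
  { σ with mark := Function.update σ.mark i (Function.update (σ.mark i) j k) }

variable (σ : Config) (x y k a b i j : ℕ) (l : List ℕ)

@[simp] theorem reg_set : (σ.set x k).reg y = if y = x then k else σ.reg y := by
  simp [set, Function.update_apply]

@[simp] theorem rows_set : (σ.set x k).rows = σ.rows := rfl

@[simp] theorem mark_set : (σ.set x k).mark = σ.mark := rfl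

@[simp] theorem reg_setRow : (σ.setRow a i l).reg = σ.reg := rfl

@[simp] theorem mark_setRow : (σ.setRow a i l).mark = σ.mark := rfl

@[simp] theorem rows_setRow : (σ.setRow a i l).rows b j =
    if b = a then (if j = i then l else σ.rows a j) else σ.rows b j := by
  simp only [setRow, Function.update_apply]
  split_ifs <;> simp [*]

@[simp] theorem reg_push : (σ.push a i x).reg = σ.reg := rfl

@[simp] theorem mark_push : (σ.push a i x).mark = σ.mark := rfl

@[simp] theorem rows_push : (σ.push a i x).rows b j =
    if b = a then (if j = i then σ.rows a i ++ [x] else σ.rows a j) else σ.rows b j := by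
  simp [push]

@[simp] theorem reg_setMark : (σ.setMark i j k).reg = σ.reg := rfl

@[simp] theorem rows_setMark : (σ.setMark i j k).rows = σ.rows := rfl

@[simp] theorem mark_setMark : (σ.setMark i j k).mark a b =
    if a = i then (if b = j then k else σ.mark i b) else σ.mark a b := by
  simp only [setMark, Function.update_apply]
  split_ifs <;> simp [*]

end Config

/-- The configuration `σ` describes the machine state `s`, where array `0` has the content `D`.  The
registers from number `20` on are left out; they serve as scratch registers. -/
structure Represents (D : ℕ → ℕ → ℕ) (σ : Config) (s : MachineState) : Prop where
  reg : ∀ x < 20, s.reg x = σ.reg x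
  rows : ∀ a, 1 ≤ a → a ≤ 3 → HoldsRows (s.mem a) (σ.rows a)
  data : s.mem 0 = D
  mark : s.mem 4 = σ.mark

/-- Started in a state described by `σ`, the program `c` halts within `T` steps, in a state that is
described by a configuration with the property `Q`. -/
def Establishes (D : ℕ → ℕ → ℕ) (c : Program) (T : ℕ) (Q : Config → Prop) (σ : Config) : Prop :=
  ∀ s, Represents D σ s → ∃ t s' σ', Runs c s t s' ∧ t ≤ T ∧ Represents D σ' s' ∧ Q σ'

/-- Execute programs one after the other. -/
def Program.block : List Program → Program
  | [] => .skip
  | c :: l => .seq c (block l)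

/-- `while i < N do (c; i := i + 1)`. -/
def Program.forLT (i N : ℕ) (c : Program) : Program :=
  .whileLT i N (.seq c (.inc i i))

/-- Append the content of register `x` to the list in row number `i` of array `a`. -/
def Program.append (a i x : ℕ) : Program :=
  .seq (.const 20 0) (.seq (.load 21 a i 20) (.seq (.inc 21 21)
    (.seq (.store a i 21 x) (.store a i 20 21))))

namespace Represents

variable {D : ℕ → ℕ → ℕ} {σ : Config} {s : MachineState}

theorem set (h : Represents D σ s) (x k : ℕ) : Represents D (σ.set x k) (s.setReg x k) := by
  refine ⟨fun y hy => ?_, h.rows, h.data, h.mark⟩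
  simp only [Config.reg_set, MachineState.setReg, Function.update_apply, h.reg y hy]

end Represents

theorem HoldsRows.update {A B : ℕ → ℕ → ℕ} {f : ℕ → List ℕ} (h : HoldsRows A f) {i : ℕ}
    {l : List ℕ} (hB : ∀ j, j ≠ i → B j = A j) (h0 : B i 0 = l.length)
    (h1 : ∀ k, ∀ hk : k < l.length, B i (k + 1) = l[k]) :
    HoldsRows B (Function.update f i l) := by
  intro j
  by_cases hj : j = i
  · subst hj
    rw [Function.update_self]
    exact ⟨h0, h1⟩
  · rw [Function.update_of_ne hj, hB j hj]
    exact h j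

namespace Establishes

variable {D : ℕ → ℕ → ℕ} {c d : Program} {T T₁ T₂ : ℕ} {Q R : Config → Prop} {σ : Config}

theorem mono (h : Establishes D c T₁ R σ) (hT : T₁ ≤ T) (hQ : ∀ σ, R σ → Q σ) :
    Establishes D c T Q σ := by
  intro s hs
  obtain ⟨t, s', σ', h1, h2, h3, h4⟩ := h s hs
  exact ⟨t, s', σ', h1, h2.trans hT, h3, hQ _ h4⟩

/-- The postcondition of c is the correctness of d, so that nested applications execute a program
symbolically. -/
theorem seq (h : Establishes D c T₁ (fun σ' => Establishes D d T₂ Q σ') σ) :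
    Establishes D (.seq c d) (T₁ + T₂) Q σ := by
  intro s hs
  obtain ⟨t, s', σ', h1, h2, h3, h4⟩ := h s hs
  obtain ⟨t', s'', σ'', h5, h6, h7, h8⟩ := h4 s' h3
  exact ⟨t + t', s'', σ'', .seq _ _ _ _ _ _ _ h1 h5, by omega, h7, h8⟩

theorem cons {l : List Program}
    (h : Establishes D c T₁ (fun σ' => Establishes D (.block l) T₂ Q σ') σ) :
    Establishes D (.block (c :: l)) (T₁ + T₂) Q σ :=
  seq h

theorem nil (h : Q σ) : Establishes D (.block []) 1 Q σ :=
  fun s hs => ⟨1, s, σ, .skip s, le_rfl, hs, h⟩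

theorem single (h : Establishes D c T Q σ) : Establishes D (.block [c]) (T + 1) Q σ :=
  cons (h.mono le_rfl fun _ h => nil h)

theorem chain {l : List Program} (h : Establishes D c T₁ R σ) (hT : T₁ + T₂ ≤ T)
    (h' : ∀ τ, R τ → Establishes D (.block l) T₂ Q τ) : Establishes D (.block (c :: l)) T Q σ :=
  (cons (h.mono le_rfl h')).mono hT fun _ h => h

theorem skip (h : Q σ) : Establishes D .skip 1 Q σ :=
  fun s hs => ⟨1, s, σ, .skip s, le_rfl, hs, h⟩

theorem const {x k : ℕ} (h : Q (σ.set x k)) : Establishes D (.const x k) 1 Q σ :=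
  fun s hs => ⟨1, _, _, .const s x k, le_rfl, hs.set x k, h⟩

theorem copy {x y : ℕ} (h : Q (σ.set x (σ.reg y))) (hy : y < 20 := by decide) :
    Establishes D (.copy x y) 1 Q σ :=
  fun s hs => ⟨1, _, _, .copy s x y, le_rfl, by rw [hs.reg y hy]; exact hs.set x _, h⟩

theorem inc {x y : ℕ} (h : Q (σ.set x (σ.reg y + 1))) (hy : y < 20 := by decide) :
    Establishes D (.inc x y) 1 Q σ :=
  fun s hs => ⟨1, _, _, .inc s x y, le_rfl, by rw [hs.reg y hy]; exact hs.set x _, h⟩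

theorem load_data {x i j : ℕ} (h : Q (σ.set x (D (σ.reg i) (σ.reg j))))
    (hi : i < 20 := by decide) (hj : j < 20 := by decide) :
    Establishes D (.load x 0 i j) 1 Q σ :=
  fun s hs => ⟨1, _, _, .load s x 0 i j, le_rfl, by
    rw [hs.reg i hi, hs.reg j hj, hs.data]; exact hs.set x _, h⟩

theorem load_mark {x i j : ℕ} (h : Q (σ.set x (σ.mark (σ.reg i) (σ.reg j))))
    (hi : i < 20 := by decide) (hj : j < 20 := by decide) :
    Establishes D (.load x 4 i j) 1 Q σ :=
  fun s hs => ⟨1, _, _, .load s x 4 i j, le_rfl, by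
    rw [hs.reg i hi, hs.reg j hj, hs.mark]; exact hs.set x _, h⟩

theorem load_length {x a i j : ℕ} (hzero : σ.reg j = 0)
    (h : Q (σ.set x (σ.rows a (σ.reg i)).length))
    (ha : 1 ≤ a ∧ a ≤ 3 := by decide) (hi : i < 20 := by decide) (hj : j < 20 := by decide) :
    Establishes D (.load x a i j) 1 Q σ :=
  fun s hs => ⟨1, _, _, .load s x a i j, le_rfl, by
    rw [hs.reg i hi, hs.reg j hj, hzero, (hs.rows a ha.1 ha.2 _).1]; exact hs.set x _, h⟩

theorem load_entry {x a i j k : ℕ} (hjk : σ.reg j = k + 1) (hk : k < (σ.rows a (σ.reg i)).length)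
    (h : Q (σ.set x (σ.rows a (σ.reg i))[k]))
    (ha : 1 ≤ a ∧ a ≤ 3 := by decide) (hi : i < 20 := by decide) (hj : j < 20 := by decide) :
    Establishes D (.load x a i j) 1 Q σ :=
  fun s hs => ⟨1, _, _, .load s x a i j, le_rfl, by
    rw [hs.reg i hi, hs.reg j hj, hjk, (hs.rows a ha.1 ha.2 _).2 k hk]; exact hs.set x _, h⟩

theorem store_mark {i j x : ℕ} (h : Q (σ.setMark (σ.reg i) (σ.reg j) (σ.reg x)))
    (hi : i < 20 := by decide) (hj : j < 20 := by decide) (hx : x < 20 := by decide) :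
    Establishes D (.store 4 i j x) 1 Q σ := by
  refine fun s hs => ⟨1, _, σ.setMark _ _ _, .store s 4 i j x, le_rfl, ⟨hs.reg, fun a h1 h2 => ?_, ?_, ?_⟩, h⟩
  · simp only [MachineState.setMem]
    rw [Function.update_of_ne (by omega)]
    exact hs.rows a h1 h2
  · simp only [MachineState.setMem]
    rw [Function.update_of_ne (by omega)]
    exact hs.data
  · simp only [MachineState.setMem]
    rw [Function.update_self, hs.reg i hi, hs.reg j hj, hs.reg x hx, hs.mark]
    rfl

/-- Register z serves as column and as value: overwriting the length by 0 empties the row, whatever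
remains in its other cells. -/
theorem clear {a i z : ℕ} (hzero : σ.reg z = 0) (h : Q (σ.setRow a (σ.reg i) []))
    (ha : 1 ≤ a ∧ a ≤ 3 := by decide) (hi : i < 20 := by decide) (hz : z < 20 := by decide) :
    Establishes D (.store a i z z) 1 Q σ := by
  refine fun s hs => ⟨1, _, σ.setRow a _ [], .store s a i z z, le_rfl, ⟨hs.reg, fun b h1 h2 => ?_, ?_, ?_⟩, h⟩
  · by_cases hb : b = a
    · subst hb
      simp only [MachineState.setMem, Config.setRow, Function.update_self]
      rw [hs.reg i hi, hs.reg z hz, hzero]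
      refine (hs.rows b h1 h2).update (fun j hj => Function.update_of_ne hj _ _) (by simp)
        (by simp)
    · simp only [MachineState.setMem, Config.setRow, Function.update_of_ne hb]
      exact hs.rows b h1 h2
  · simp only [MachineState.setMem]
    rw [Function.update_of_ne (by omega)]
    exact hs.data
  · simp only [MachineState.setMem]
    rw [Function.update_of_ne (by omega)]
    exact hs.mark

theorem append {a i x : ℕ} (h : Q (σ.push a (σ.reg i) (σ.reg x)))
    (ha : 1 ≤ a ∧ a ≤ 3 := by decide) (hi : i < 20 := by decide) (hx : x < 20 := by decide) :
    Establishes D (.append a i x) 5 Q σ := by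
  intro s hs
  refine ⟨5, _, σ.push a _ _, .seq _ _ _ _ _ 1 4 (.const _ _ _) (.seq _ _ _ _ _ 1 3 (.load _ _ _ _ _)
    (.seq _ _ _ _ _ 1 2 (.inc _ _ _) (.seq _ _ _ _ _ 1 1 (.store _ _ _ _ _) (.store _ _ _ _ _)))),
    le_rfl, ⟨fun y hy => ?_, fun b h1 h2 => ?_, ?_, ?_⟩, h⟩
  · simp only [MachineState.setMem, MachineState.setReg, Config.reg_push]
    rw [Function.update_of_ne (by omega), Function.update_of_ne (by omega),
      Function.update_of_ne (by omega), hs.reg y hy]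
  · by_cases hb : b = a
    · subst hb
      have hi0 : i ≠ 20 := by omega
      have hi1 : i ≠ 21 := by omega
      have hx0 : x ≠ 20 := by omega
      have hx1 : x ≠ 21 := by omega
      have hl := (hs.rows b h1 h2 (σ.reg i)).1
      simp only [MachineState.setMem, MachineState.setReg, Config.push, Config.setRow,
        Function.update_self, ne_eq, hi0, hi1, hx0, hx1, not_false_eq_true, Function.update_of_ne,
        show (20 : ℕ) ≠ 21 by decide, hs.reg i hi, hs.reg x hx, hl]
      refine (hs.rows b h1 h2).update (fun j hj => ?_) ?_ ?_
      · simp [hj]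
      · simp
      · intro k hk
        simp only [Function.update_self]
        rw [Function.update_of_ne (by omega), Function.update_apply]
        rw [List.length_append, List.length_singleton] at hk
        split_ifs with hk'
        · obtain rfl : k = (σ.rows b (σ.reg i)).length := by omega
          simp
        · rw [List.getElem_append_left (by omega), (hs.rows b h1 h2 (σ.reg i)).2 k (by omega)]
    · simp only [MachineState.setMem, MachineState.setReg, Config.push, Config.setRow,
        Function.update_of_ne hb]
      exact hs.rows b h1 h2
  · simp only [MachineState.setMem, MachineState.setReg]
    rw [Function.update_of_ne (by omega), Function.update_of_ne (by omega), hs.data]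
  · simp only [MachineState.setMem, MachineState.setReg]
    rw [Function.update_of_ne (by omega), Function.update_of_ne (by omega), hs.mark]
    rfl

theorem ifLT {x y : ℕ} (h₁ : σ.reg x < σ.reg y → Establishes D c T Q σ)
    (h₂ : ¬ σ.reg x < σ.reg y → Establishes D d T Q σ) (hx : x < 20 := by decide)
    (hy : y < 20 := by decide) : Establishes D (.ifLT x y c d) (T + 1) Q σ := by
  intro s hs
  by_cases h : σ.reg x < σ.reg y
  · obtain ⟨t, s', σ', h1, h2, h3, h4⟩ := h₁ h s hs
    exact ⟨_, s', σ', .ifLT_true _ _ _ _ _ _ _ (by rwa [hs.reg x hx, hs.reg y hy]) h1, by omega, h3,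
      h4⟩
  · obtain ⟨t, s', σ', h1, h2, h3, h4⟩ := h₂ h s hs
    exact ⟨_, s', σ', .ifLT_false _ _ _ _ _ _ _ (by rwa [hs.reg x hx, hs.reg y hy]) h1, by omega,
      h3, h4⟩

/-- Each iteration pays two steps beyond its body, for the test and the increment; the last, failing
test is the final 1. -/
theorem forLT {i N b : ℕ} (inv : ℕ → Config → Prop) (T : ℕ → ℕ) (a : ℕ) (hab : a ≤ b)
    (h0 : inv a σ) (hreg : ∀ k σ, inv k σ → σ.reg i = k ∧ σ.reg N = b)
    (hbody : ∀ k σ, a ≤ k → k < b → inv k σ →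
      Establishes D c (T k) (fun σ => inv (k + 1) (σ.set i (σ.reg i + 1))) σ)
    (hQ : ∀ σ, inv b σ → Q σ) (hi : i < 20 := by decide) (hN : N < 20 := by decide) :
    Establishes D (.forLT i N c) (∑ k ∈ Finset.Ico a b, (T k + 2) + 1) Q σ := by
  obtain ⟨m, rfl⟩ := Nat.exists_eq_add_of_le hab
  clear hab
  induction m generalizing a σ with
  | zero =>
    intro s hs
    obtain ⟨h1, h2⟩ := hreg _ _ h0
    exact ⟨1, s, σ, .while_false _ _ _ _ (by rw [hs.reg i hi, hs.reg N hN]; omega), by omega, hs,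
      hQ _ h0⟩
  | succ m ih =>
    intro s hs
    obtain ⟨h1, h2⟩ := hreg _ _ h0
    obtain ⟨t, s', σ', h3, h4, h5, h6⟩ := (seq (T₂ := 1)
      ((hbody a σ le_rfl (by omega) h0).mono le_rfl fun σ h => inc h hi)) s hs
    have e : a + 1 + m = a + (m + 1) := by omega
    obtain ⟨t', s'', σ'', h7, h8, h9, h10⟩ := ih (a + 1) h6 (fun k σ hk => e ▸ hreg k σ hk)
      (fun k σ hk hk' => hbody k σ (by omega) (by omega)) (fun σ hσ => hQ σ (e ▸ hσ)) s' h5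
    refine ⟨_, s'', σ'', .while_true _ _ _ _ _ _ _ _ (by rw [hs.reg i hi, hs.reg N hN]; omega) h3
      h7, ?_, h9, h10⟩
    rw [Finset.sum_eq_sum_Ico_succ_bot (by omega), ← e]
    omega

end Establishes

/-! ### The program for the incomplete lists. -/

namespace Program

/-- Compute `2 * p` and `3 * p` in the registers `6` and `7`. -/
def prepare : Program :=
  -- Multiples of p are built by increments. Register 12 is the constant 1; register 11 is never
  -- written and stays 0.
  block [copy 6 0, copy 7 0, const 12 1, const 2 0,
    forLT 2 0 (block [inc 6 6, inc 7 7, inc 7 7])]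

/-- Start the rows of the arrays `1`, `2` and `3`. -/
def startRows : Program :=
  block [const 2 0, copy 3 0,
    -- The initial entry p + i is the first choice of agent (0,i); in array 3 it is a dummy that
    -- lets `transpose` treat all arrays alike.
    forLT 2 0 (block [append 1 2 3, append 2 2 3, append 3 2 3, inc 3 3])]

/-- Append the heads of the edges from `i` to row `i` of array `3`. -/
def readEdges : Program :=
  block [const 2 0, forLT 2 1 (block [load 9 0 2 11, load 10 0 2 12, append 3 9 10])]

/-- For all `i` and all entries `j` of row `i` of array `a` but the first one, append `i` to row `j` of
array `b`. -/
def transpose (a b : ℕ) : Program :=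
  -- Register 5 starts at 2 because cell 0 holds the length and cell 1 the initial entry; the bound
  -- is the length plus one.
  block [const 2 0, forLT 2 0 (block [load 8 a 2 11, inc 8 8, const 5 2,
    forLT 5 8 (block [load 9 a 2 5, append b 9 2])])]

/-- Finish the rows of the arrays `1` and `2`. -/
def finishRows : Program :=
  block [const 2 0, copy 3 0, copy 4 6,
    forLT 2 0 (block [append 1 2 4, append 1 3 4, append 1 3 2, append 1 4 2, append 1 4 3,
      append 2 2 4, append 2 3 4, append 2 3 2, append 2 4 2, append 2 4 3, inc 3 3, inc 4 4])]

/-- Write down the lists without harmless pairs. -/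
def coreLists : Program :=
  -- A transposition visits the rows in increasing order, so its output rows are sorted. The first
  -- one yields the predecessors, the second one the successors.
  block [prepare, startRows, readEdges, transpose 3 1, transpose 1 2, finishRows]

end Program

/-- The contents of the registers with a fixed meaning. -/
def StandardRegisters (p q : ℕ) (σ : Config) : Prop :=
  σ.reg 0 = p ∧ σ.reg 1 = q ∧ σ.reg 6 = 2 * p ∧ σ.reg 7 = 3 * p ∧ σ.reg 11 = 0 ∧ σ.reg 12 = 1

/-- The configuration in the beginning. -/
def initialConfig (p q : ℕ) : Config :=
  ⟨fun x => if x = 0 then p else if x = 1 then q else 0, fun _ _ => [], fun _ _ => 0⟩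

theorem represents_inputState {p q : ℕ} (E : Fin q → Fin p × Fin p) :
    Represents ((inputState E).mem 0) (initialConfig p q) (inputState E) := by
  refine ⟨fun x _ => rfl, fun a h1 h2 i => ?_, rfl, ?_⟩
  · have : a ≠ 0 := by omega
    simp [inputState, initialConfig, this]
  · funext i j
    simp [inputState, initialConfig]

theorem inputState_mem {p q : ℕ} (E : Fin q → Fin p × Fin p) {k : ℕ}
    (hk : k < (edgeList E).length) : (inputState E).mem 0 k 0 = ((edgeList E)[k]).1 ∧
      (inputState E).mem 0 k 1 = ((edgeList E)[k]).2 := by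
  have hk' : k < q := by simpa [edgeList] using hk
  simp [inputState, edgeList, hk']

/-! ### Correctness and running time of the linear program. -/

section

variable {D : ℕ → ℕ → ℕ} {p q : ℕ}

theorem establishes_prepare : Establishes D .prepare (8 * p + 20)
    (fun σ => StandardRegisters p q σ ∧ σ.rows = (fun _ _ => []) ∧ σ.mark = fun _ _ => 0)
    (initialConfig p q) := by
  refine .mono (T₁ := _) (R := _) (.cons (.copy (.cons (.copy (.cons (.const (.cons (.const
    (.single (.forLT (fun k σ => σ.reg 0 = p ∧ σ.reg 1 = q ∧ σ.reg 2 = k ∧ σ.reg 6 = p + k ∧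
      σ.reg 7 = p + 2 * k ∧ σ.reg 11 = 0 ∧ σ.reg 12 = 1 ∧ σ.rows = (fun _ _ => []) ∧
      σ.mark = fun _ _ => 0) (fun _ => 4) 0 (Nat.zero_le p) ?_ ?_ ?_ ?_))))))))))
    ?_ fun _ h => h
  · simp [initialConfig]
  · rintro k σ h
    exact ⟨h.2.2.1, h.1⟩
  · rintro k σ - hk ⟨h0, h1, h2, h6, h7, h11, h12, hr, hm⟩
    refine .cons (.inc (.cons (.inc (.cons (.inc (.nil ?_))))))
    simp [*]
    omega
  · rintro σ ⟨h0, h1, h2, h6, h7, h11, h12, hr, hm⟩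
    refine ⟨⟨h0, h1, ?_, ?_, h11, h12⟩, hr, hm⟩ <;> omega
  · simp
    omega

theorem establishes_startRows {σ : Config} (hσ : StandardRegisters p q σ)
    (hrows : σ.rows = fun _ _ => []) : Establishes D .startRows (20 * p + 20)
    (fun τ => StandardRegisters p q τ ∧ τ.mark = σ.mark ∧
      ∀ a, 1 ≤ a → a ≤ 3 → ∀ i, τ.rows a i = if i < p then [p + i] else []) σ := by
  obtain ⟨h0, h1, h6, h7, h11, h12⟩ := hσ
  refine .mono (T₁ := _) (R := _) (.cons (.const (.cons (.copy (.single (.forLT (fun k τ =>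
    StandardRegisters p q τ ∧ τ.reg 2 = k ∧ τ.reg 3 = p + k ∧ τ.mark = σ.mark ∧
      ∀ a, 1 ≤ a → a ≤ 3 → ∀ i, τ.rows a i = if i < k then [p + i] else [])
    -- Three appends of five steps each, an increment, and the `skip` that ends a block.
    (fun _ => 17) 0 (Nat.zero_le p) ?_ ?_ ?_ ?_)))))) ?_ fun _ h => h
  · simp [StandardRegisters, *]
  · rintro k τ ⟨h, h2, -⟩
    exact ⟨h2, h.1⟩
  · rintro k τ - hk ⟨⟨h0, h1, h6, h7, h11, h12⟩, h2, h3, hm, hr⟩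
    refine .cons (.append (.cons (.append (.cons (.append (.cons (.inc (.nil ?_))))))))
    refine ⟨by simp [StandardRegisters, *], by simp [*], by simp [*]; omega, by simp [*], ?_⟩
    intro a ha ha' i
    have hri := hr a ha ha' i
    have hrk := hr a ha ha' k
    obtain rfl | rfl | rfl : a = 1 ∨ a = 2 ∨ a = 3 := by omega
    all_goals
      by_cases hik : i = k
      · simp [*]
      · have : i < k + 1 ↔ i < k := by omega
        simp [*]
  · rintro τ ⟨h, -, -, hm, hr⟩
    exact ⟨h, hm, hr⟩
  · simp
    omega

theorem establishes_readEdges {l : List (ℕ × ℕ)} (hl : l.length = q)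
    (hD : ∀ k, ∀ hk : k < l.length, D k 0 = (l[k]).1 ∧ D k 1 = (l[k]).2)
    {σ : Config} (hσ : StandardRegisters p q σ) :
    Establishes D .readEdges (10 * q + 20)
    (fun τ => StandardRegisters p q τ ∧ τ.mark = σ.mark ∧ (∀ a, a ≠ 3 → τ.rows a = σ.rows a) ∧
      ∀ i, τ.rows 3 i = σ.rows 3 i ++ (l.filter fun e => e.1 = i).map Prod.snd) σ := by
  obtain ⟨h0, h1, h6, h7, h11, h12⟩ := hσ
  refine .mono (T₁ := _) (R := _) (.cons (.const (.single (.forLT (fun k τ =>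
    StandardRegisters p q τ ∧ τ.reg 2 = k ∧ τ.mark = σ.mark ∧
      (∀ a, a ≠ 3 → τ.rows a = σ.rows a) ∧ ∀ i, τ.rows 3 i = σ.rows 3 i ++
        ((l.take k).filter fun e => e.1 = i).map Prod.snd)
    (fun _ => 8) 0 (Nat.zero_le q) ?_ ?_ ?_ ?_)))) ?_ fun _ h => h
  · simp [StandardRegisters, *]
  · rintro k τ ⟨h, h2, -⟩
    exact ⟨h2, h.2.1⟩
  · rintro k τ - hk ⟨⟨h0, h1, h6, h7, h11, h12⟩, h2, hm, ha, hr⟩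
    have hD' := hD k (by omega)
    refine .cons (.load_data (.cons (.load_data (.cons (.append (.nil ?_))))))
    refine ⟨by simp [StandardRegisters, *], by simp [*], by simp [*], ?_, ?_⟩
    · intro a ha3
      funext i
      simp [*]
    · intro i
      rw [← List.take_append_getElem (by omega : k < l.length), List.filter_append, List.map_append]
      by_cases hi : (l[k]).1 = i
      · subst hi
        simp [*]
      · have hi' : i ≠ (l[k]).1 := Ne.symm hi
        simp [hi', hi, h2, h11, h12, hD', hr]
  · rintro τ ⟨h, -, hm, ha, hr⟩
    refine ⟨h, hm, ha, fun i => ?_⟩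
    rw [hr, ← hl, List.take_length]
  · simp
    omega

/-- Every entry costs a constant, so the time is linear in the number of rows and entries. Without
repetitions in f i, the number i is appended at most once to each row. -/
theorem establishes_transpose {a b : ℕ} (ha : 1 ≤ a ∧ a ≤ 3) (hb : 1 ≤ b ∧ b ≤ 3) (hab : a ≠ b)
    {σ : Config} (hσ : StandardRegisters p q σ) {x : ℕ → ℕ} {f : ℕ → List ℕ}
    (hf : ∀ i < p, σ.rows a i = x i :: f i) (hn : ∀ i < p, (f i).Nodup) :
    Establishes D (.transpose a b) (∑ i ∈ Finset.range p, (9 * (f i).length + 15) + 20)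
    (fun τ => StandardRegisters p q τ ∧ τ.mark = σ.mark ∧ (∀ c, c ≠ b → τ.rows c = σ.rows c) ∧
      ∀ j, τ.rows b j = σ.rows b j ++ (List.range p).filter fun i => j ∈ f i) σ := by
  obtain ⟨h0, h1, h6, h7, h11, h12⟩ := hσ
  refine .mono (T₁ := _) (R := _) (.cons (.const (.single (.forLT (fun k τ =>
    StandardRegisters p q τ ∧ τ.reg 2 = k ∧ τ.mark = σ.mark ∧
      (∀ c, c ≠ b → τ.rows c = σ.rows c) ∧
      ∀ j, τ.rows b j = σ.rows b j ++ (List.range k).filter fun i => j ∈ f i)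
    (fun k => 9 * (f k).length + 12) 0 (Nat.zero_le p) ?_ ?_ ?_ ?_)))) ?_ fun _ h => h
  · simp [StandardRegisters, *]
  · rintro k τ ⟨h, h2, -⟩
    exact ⟨h2, h.1⟩
  · rintro k τ - hk ⟨⟨h0, h1, h6, h7, h11, h12⟩, h2, hm, hc, hr⟩
    have hrow : τ.rows a k = x k :: f k := by rw [hc a hab, hf k hk]
    refine .mono (T₁ := _) (R := _) (.cons (.load_length h11 (.cons (.inc (.cons (.const
      (.single (.forLT (fun m υ => StandardRegisters p q υ ∧ υ.reg 2 = k ∧ υ.reg 5 = m ∧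
        υ.reg 8 = (f k).length + 2 ∧ υ.mark = σ.mark ∧ (∀ c, c ≠ b → υ.rows c = σ.rows c) ∧
        ∀ j, υ.rows b j = τ.rows b j ++ if j ∈ (f k).take (m - 2) then [k] else [])
      (fun _ => 7) 2 (b := (f k).length + 2) (Nat.le_add_left _ _) ?_ ?_ ?_ ?_))))))
      ha)) ?_ fun _ h => h
    · simp [StandardRegisters, *]
      exact hc
    · rintro m υ ⟨h, -, h5, h8, -⟩
      exact ⟨h5, h8⟩
    · rintro m υ hm2 hml ⟨⟨h0, h1, h6, h7, h11, h12⟩, h2', h5, h8, hm', hc', hr'⟩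
      have hrow' : υ.rows a (υ.reg 2) = x k :: f k := by rw [h2', hc' a hab, hf k hk]
      obtain ⟨m, rfl⟩ := Nat.exists_eq_add_of_le' hm2
      have hml' : m < (f k).length := by omega
      refine .cons (.load_entry (k := m + 1) h5 (by simp [hrow']; omega) (.cons (.append (.nil ?_) hb))
        ha)
      have hval : (υ.rows a (υ.reg 2))[m + 1]'(by simp [hrow']; omega) = (f k)[m] := by
        simp [hrow']
      refine ⟨by simp [StandardRegisters, *], by simp [*], by simp [*], by simp [*], by simp [*],
        ?_, ?_⟩
      · intro c hcb
        funext i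
        simp [*]
      · intro j
        have hnm := hn k hk
        rw [hval]
        have htake : j ∈ (f k).take (m + 2 + 1 - 2) ↔ j ∈ (f k).take m ∨ j = (f k)[m] := by
          rw [show m + 2 + 1 - 2 = m + 1 by omega, ← List.take_append_getElem hml',
            List.mem_append, List.mem_singleton]
        simp only [htake]
        by_cases hj : j = (f k)[m]
        · subst hj
          have hnot : (f k)[m] ∉ (f k).take m := by
            have := (List.take_sublist (m + 1) (f k)).nodup hnm
            rw [← List.take_append_getElem hml', List.nodup_append] at this
            exact fun h => this.2.2 _ h _ (by simp) rfl
          simp [hr', h2', hnot]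
        · simp [hr', hj]
    · rintro υ ⟨h, h2', h5, h8, hm', hc', hr'⟩
      refine ⟨by simpa [StandardRegisters] using h, by simp [h2'], by simp [hm'], ?_, ?_⟩
      · intro c hcb
        simp [hc' c hcb]
      · intro j
        rw [List.range_succ, List.filter_append]
        by_cases hj : j ∈ f k
        · simp [hr', hr, hj]
        · simp [hr', hr, hj]
    · simp
      omega
  · rintro τ ⟨h, -, hm, hc, hr⟩
    exact ⟨h, hm, hc, hr⟩
  · simp only [Finset.range_eq_Ico]
    have : ∑ k ∈ Finset.Ico 0 p, (9 * (f k).length + 12 + 2) ≤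
        ∑ k ∈ Finset.Ico 0 p, (9 * (f k).length + 15) :=
      Finset.sum_le_sum fun _ _ => by omega
    omega

end

/-- Row `r` after `k` iterations of the loop of `finishRows`. -/
def partialRow (p : ℕ) (adj : ℕ → List ℕ) (k r : ℕ) : List ℕ :=
  if r < p then (p + r) :: (adj r ++ if r < k then [2 * p + r] else [])
  else if r < 2 * p then (if r - p < k then [p + r, r - p] else [])
  else if r - 2 * p < k then [r - 2 * p, r - p] else []

section

variable {D : ℕ → ℕ → ℕ} {p q : ℕ}

/-- An iteration completes the rows k, p + k and 2 * p + k of one gadget and touches no others. -/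
theorem partialRow_succ {adj : ℕ → List ℕ} {k r : ℕ} (hk : k < p) :
    partialRow p adj (k + 1) r =
      if r = k then partialRow p adj k r ++ [2 * p + k]
      else if r = p + k then (partialRow p adj k r ++ [2 * p + k]) ++ [k]
      else if r = 2 * p + k then (partialRow p adj k r ++ [k]) ++ [p + k]
      else partialRow p adj k r := by
  have n1 : p ≠ 0 := by omega
  have n2 : 2 * p ≠ p := by omega
  unfold partialRow
  by_cases h1 : r = k
  · subst h1
    simp [hk]
  · by_cases h2 : r = p + k
    · subst h2
      have : p + k < 2 * p := by omega
      simp [this, n1]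
      omega
    · by_cases h3 : r = 2 * p + k
      · subst h3
        have h4 : ¬ 2 * p + k < p := by omega
        simp [h4, n1, n2]
        omega
      · have e1 : r < p → (r < k + 1 ↔ r < k) := by omega
        have e2 : ¬ r < p → (r - p < k + 1 ↔ r - p < k) := by omega
        have e3 : ¬ r < 2 * p → (r - 2 * p < k + 1 ↔ r - 2 * p < k) := by omega
        rw [if_neg h1, if_neg h2, if_neg h3]
        split_ifs <;> first | rfl | omega

theorem partialRow_self {adj : ℕ → List ℕ} {r : ℕ} (hr : r < 3 * p) :
    partialRow p adj p r = coreRow p adj r := by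
  unfold partialRow coreRow
  split_ifs <;> first | rfl | omega

theorem establishes_finishRows {σ : Config} (hσ : StandardRegisters p q σ) {adj : ℕ → ℕ → List ℕ}
    (hrows : ∀ a, 1 ≤ a → a ≤ 2 → ∀ i, σ.rows a i = if i < p then (p + i) :: adj a i else []) :
    Establishes D .finishRows (60 * p + 20)
    (fun τ => StandardRegisters p q τ ∧ τ.mark = σ.mark ∧
      ∀ a, 1 ≤ a → a ≤ 2 → ∀ i < 3 * p, τ.rows a i = coreRow p (adj a) i) σ := by
  obtain ⟨h0, h1, h6, h7, h11, h12⟩ := hσ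
  refine .mono (T₁ := _) (R := _) (.cons (.const (.cons (.copy (.cons (.copy (.single (.forLT
    (fun k τ => StandardRegisters p q τ ∧ τ.reg 2 = k ∧ τ.reg 3 = p + k ∧ τ.reg 4 = 2 * p + k ∧
      τ.mark = σ.mark ∧ ∀ a, 1 ≤ a → a ≤ 2 → ∀ i, τ.rows a i = partialRow p (adj a) k i)
    (fun _ => 53) 0 (Nat.zero_le p) ?_ ?_ ?_ ?_)))))))) ?_ fun _ h => h
  · refine ⟨by simp [StandardRegisters, *], by simp, by simp [*], by simp [*], by simp, ?_⟩
    intro a ha ha' i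
    simp only [Config.rows_set, hrows a ha ha', partialRow]
    simp
  · rintro k τ ⟨h, h2, -⟩
    exact ⟨h2, h.1⟩
  · rintro k τ - hk ⟨⟨h0, h1, h6, h7, h11, h12⟩, h2, h3, h4, hm, hr⟩
    refine .cons (.append (.cons (.append (.cons (.append (.cons (.append (.cons (.append
      (.cons (.append (.cons (.append (.cons (.append (.cons (.append (.cons (.append
      (.cons (.inc (.cons (.inc (.nil ?_))))))))))))))))))))))))
    refine ⟨by simp [StandardRegisters, *], by simp [*], by simp [*]; omega, by simp [*]; omega,
      by simp [*], ?_⟩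
    intro a ha ha' i
    have n1 : p ≠ 0 := by omega
    have n2 : 2 * p ≠ p := by omega
    rw [partialRow_succ hk]
    obtain rfl | rfl : a = 1 ∨ a = 2 := by omega
    all_goals
      have e := hr _ ha ha'
      by_cases i1 : i = k
      · subst i1
        simp [h2, h3, h4, e, n1]
      · by_cases i2 : i = p + k
        · subst i2
          simp [h2, h3, h4, e, n1, n2.symm]
        · by_cases i3 : i = 2 * p + k
          · subst i3
            simp [h2, h3, h4, e, n1, n2]
          · simp [h2, h3, h4, e, i1, i2, i3]
  · rintro τ ⟨h, -, -, -, hm, hr⟩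
    exact ⟨h, hm, fun a ha ha' i hi => by rw [hr a ha ha', partialRow_self hi]⟩
  · simp
    omega

end

/-! ### The programs for complete lists. -/

namespace Program

/-- Append `lo, …, hi - 1` to the list in row number `2` of array `a`, for the contents `lo` and `hi`
of the given registers. -/
def appendRange (a lo hi : ℕ) : Program :=
  block [copy 5 lo, forLT 5 hi (append a 2 5)]

/-- Replace the lists in array `a` by complete ones. -/
def fullLists (a : ℕ) : Program :=
  block [const 2 0, forLT 2 7 (block [store a 2 11 11,
    ifLT 2 0 (block [appendRange a 0 6, appendRange a 11 0, appendRange a 6 7])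
      (block [appendRange a 6 7, appendRange a 11 0, appendRange a 0 6])])]

/-- Append the missing entries to the lists in array `a`. -/
def fillLists (a : ℕ) : Program :=
  -- Row i of array 4 marks the entries of list i. Each list has a mark row of its own, so no marks
  -- need to be erased.
  block [const 2 0, forLT 2 7 (block [load 8 a 2 11, inc 8 8, const 5 1,
    forLT 5 8 (block [load 9 a 2 5, store 4 2 9 12]), const 5 0,
    forLT 5 7 (block [load 9 4 2 5, ifLT 9 12 (append a 2 5) skip])])]

end Program

/-! ### Correctness and running time of the programs. -/

section

variable {D : ℕ → ℕ → ℕ} {p q : ℕ}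

/-- The fibres of g are disjoint. This bounds the total length of all adjacency lists by the number
of edges. -/
theorem sum_length_filter_le {α : Type*} (l : List α) (g : α → ℕ) (p : ℕ) :
    ∑ i ∈ Finset.range p, (l.filter fun e => g e = i).length ≤ l.length := by
  induction l with
  | nil => simp
  | cons e l ih =>
    have h : ∀ i, ((e :: l).filter fun e => g e = i).length =
        (if g e = i then 1 else 0) + (l.filter fun e => g e = i).length := by
      intro i
      by_cases hi : g e = i
      · simp [hi, Nat.add_comm]
      · simp [hi]
    simp only [h, Finset.sum_add_distrib, Finset.sum_ite_eq, List.length_cons]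
    split_ifs <;> omega

theorem sum_length_predRow_le (l : List (ℕ × ℕ)) :
    ∑ i ∈ Finset.range p, (predRow p l i).length ≤ l.length := by
  refine (Finset.sum_le_sum fun i hi => ?_).trans (sum_length_filter_le l Prod.snd p)
  rw [← List.length_map (as := l.filter fun e => e.2 = i) Prod.fst]
  refine (List.subperm_of_subset (predRow_nodup l i (Finset.mem_range.1 hi)) ?_).length_le
  intro j hj
  simp only [predRow, List.mem_filter, List.mem_range, decide_eq_true_eq] at hj
  simp [hj.2]

theorem edgeList_lt {E : Fin q → Fin p × Fin p} {e : ℕ × ℕ} (he : e ∈ edgeList E) :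
    e.1 < p ∧ e.2 < p := by
  simp only [edgeList, List.mem_ofFn] at he
  obtain ⟨k, rfl⟩ := he
  exact ⟨(E k).1.2, (E k).2.2⟩

theorem edgeList_nodup {E : Fin q → Fin p × Fin p} (hE : Function.Injective E) :
    (edgeList E).Nodup := by
  refine List.nodup_ofFn.2 fun i j hij => hE ?_
  simpa [Prod.ext_iff, Fin.ext_iff] using hij

theorem establishes_coreLists {E : Fin q → Fin p × Fin p} (hE : Function.Injective E) :
    Establishes ((inputState E).mem 0) .coreLists (200 * (p + q) + 200)
    (fun τ => StandardRegisters p q τ ∧ (τ.mark = fun _ _ => 0) ∧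
      (∀ i < 3 * p, τ.rows 1 i = coreRow p (predRow p (edgeList E)) i) ∧
      ∀ i < 3 * p, τ.rows 2 i = coreRow p (succRow p (edgeList E)) i) (initialConfig p q) := by
  set l := edgeList E with hl
  have hlq : l.length = q := by simp [hl, edgeList]
  -- The adjacency lists in the order of the input, as array 3 holds them.
  set f : ℕ → List ℕ := fun i => (l.filter fun e => e.1 = i).map Prod.snd with hf
  have mem_f : ∀ i j, j ∈ f i ↔ (i, j) ∈ l := by simp [hf]
  have hfn : ∀ i < p, (f i).Nodup := by
    intro i _
    refine ((edgeList_nodup hE).filter _).map_on ?_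
    intro a ha b hb hab
    simp only [List.mem_filter, decide_eq_true_eq] at ha hb
    exact Prod.ext (ha.2.trans hb.2.symm) hab
  have pred_nil : ∀ j, ¬ j < p → predRow p l j = [] := by
    intro j hj
    simp only [predRow, List.filter_eq_nil_iff, decide_eq_true_eq]
    exact fun i _ h => hj (edgeList_lt h).2
  have pred_eq : ∀ j, ((List.range p).filter fun i => j ∈ f i) = predRow p l j := by
    intro j
    simp only [predRow, mem_f]
  have succ_eq : ∀ j, ((List.range p).filter fun i => j ∈ predRow p l i) =
      if j < p then succRow p l j else [] := by
    intro j
    split_ifs with hj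
    · simp [predRow, succRow, hj]
    · simp [predRow, hj]
  -- Each T₂ is the time left for the remaining parts, with generous slack.
  refine .chain (T₂ := 190 * (p + q) + 170) establishes_prepare ?_ ?_
  · omega
  rintro σ₁ ⟨h₁, r₁, m₁⟩
  refine .chain (T₂ := 160 * (p + q) + 140) (establishes_startRows h₁ r₁) ?_ ?_
  · omega
  rintro σ₂ ⟨h₂, m₂, r₂⟩
  refine .chain (T₂ := 140 * (p + q) + 110) (establishes_readEdges hlq
    (fun k hk => inputState_mem E hk) h₂) ?_ ?_
  · omega
  rintro σ₃ ⟨h₃, m₃, a₃, r₃⟩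
  refine .chain (T₂ := 110 * (p + q) + 80) (establishes_transpose (a := 3) (b := 1) (by decide)
    (by decide) (by decide) h₃ (x := fun i => p + i) (f := f) (fun i hi => by
      rw [r₃, r₂ 3 (by decide) (by decide), if_pos hi]
      rfl) hfn) ?_ ?_
  · have := sum_length_filter_le l Prod.fst p
    simp only [hf, List.length_map, Finset.sum_add_distrib, ← Finset.mul_sum, Finset.sum_const,
      Finset.card_range, smul_eq_mul]
    omega
  rintro σ₄ ⟨h₄, m₄, a₄, r₄⟩
  have r₄' : ∀ j, σ₄.rows 1 j = if j < p then (p + j) :: predRow p l j else [] := by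
    intro j
    rw [r₄, a₃ 1 (by decide), r₂ 1 (by decide) (by decide), pred_eq]
    split_ifs with hj
    · rfl
    · rw [pred_nil j hj]
      rfl
  refine .chain (T₂ := 70 * (p + q) + 50) (establishes_transpose (a := 1) (b := 2) (by decide)
    (by decide) (by decide) h₄ (x := fun i => p + i) (f := predRow p l) (fun i hi => by
      rw [r₄', if_pos hi]) (predRow_nodup l)) ?_ ?_
  · have := sum_length_predRow_le (p := p) l
    simp only [Finset.sum_add_distrib, ← Finset.mul_sum, Finset.sum_const,
      Finset.card_range, smul_eq_mul]
    omega
  rintro σ₅ ⟨h₅, m₅, a₅, r₅⟩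
  refine .mono (T₁ := _) (R := _) (.single (establishes_finishRows h₅
    (adj := fun a => if a = 1 then predRow p l else succRow p l) ?_)) ?_ ?_
  · intro a ha ha' i
    obtain rfl | rfl : a = 1 ∨ a = 2 := by omega
    · rw [a₅ 1 (by decide), r₄']
      rfl
    · rw [r₅, a₄ 2 (by decide), a₃ 2 (by decide), r₂ 2 (by decide) (by decide), succ_eq]
      rw [if_neg (by decide : ¬ 2 = 1)]
      split_ifs <;> rfl
  · omega
  · rintro τ ⟨h, m, r⟩
    exact ⟨h, by rw [m, m₅, m₄, m₃, m₂, m₁], r 1 (by decide) (by decide),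
      r 2 (by decide) (by decide)⟩

theorem establishes_appendRange {a lo hi m : ℕ} {σ : Config} (ha : 1 ≤ a ∧ a ≤ 3)
    (hm : σ.reg hi = σ.reg lo + m) (hlo : lo < 20) (hhi : hi < 20) (hhi' : hi ≠ 5) :
    Establishes D (.appendRange a lo hi) (7 * m + 3)
    (fun τ => (∀ x, x ≠ 5 → τ.reg x = σ.reg x) ∧ τ.mark = σ.mark ∧ ∀ b j, τ.rows b j =
      if b = a ∧ j = σ.reg 2 then σ.rows b j ++ List.range' (σ.reg lo) m else σ.rows b j) σ := by
  refine .mono (T₁ := _) (R := _) (.cons (.copy (.single (.forLT (fun k τ => τ.reg 5 = k ∧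
      (∀ x, x ≠ 5 → τ.reg x = σ.reg x) ∧ τ.mark = σ.mark ∧ ∀ b j, τ.rows b j =
      if b = a ∧ j = σ.reg 2 then σ.rows b j ++ List.range' (σ.reg lo) (k - σ.reg lo)
      else σ.rows b j)
    (fun _ => 5) (σ.reg lo) (b := σ.reg hi) (by omega) ?_ ?_ ?_ ?_ (by decide) hhi)) hlo)) ?_
    fun _ h => h
  · refine ⟨by simp, fun x hx => by simp [hx], by simp, fun b j => by simp⟩
  · rintro k τ ⟨h5, hr, -⟩
    exact ⟨h5, hr _ hhi'⟩
  · rintro k τ hk hk' ⟨h5, hr, hmk, h⟩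
    refine .append ⟨by simp [h5], fun x hx => by simp [hx, hr], by simp [hmk], fun b j => ?_⟩ ha
    obtain ⟨d, rfl⟩ := Nat.exists_eq_add_of_le hk
    have e1 : σ.reg lo + d + 1 - σ.reg lo = d + 1 := by omega
    have e2 : σ.reg lo + d - σ.reg lo = d := by omega
    rw [e2] at h
    rw [e1, List.range'_1_concat]
    simp only [Config.rows_set, Config.rows_push, hr 2 (by decide), h5, h]
    by_cases hb : b = a
    · subst hb
      by_cases hj : j = σ.reg 2
      · subst hj
        simp
      · simp [hj]
    · simp [hb]
  · rintro τ ⟨-, hr, hmk, h⟩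
    refine ⟨hr, hmk, fun b j => ?_⟩
    rw [h, hm, Nat.add_sub_cancel_left]
  · simp [hm]
    omega

theorem establishes_three_ranges {a r₁ s₁ r₂ s₂ r₃ s₃ : ℕ} {σ : Config} (ha : 1 ≤ a ∧ a ≤ 3)
    (h₁ : σ.reg s₁ = σ.reg r₁ + p) (h₂ : σ.reg s₂ = σ.reg r₂ + p) (h₃ : σ.reg s₃ = σ.reg r₃ + p)
    (hr₁ : r₁ < 20 ∧ r₁ ≠ 5 := by decide) (hs₁ : s₁ < 20 ∧ s₁ ≠ 5 := by decide)
    (hr₂ : r₂ < 20 ∧ r₂ ≠ 5 := by decide) (hs₂ : s₂ < 20 ∧ s₂ ≠ 5 := by decide)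
    (hr₃ : r₃ < 20 ∧ r₃ ≠ 5 := by decide) (hs₃ : s₃ < 20 ∧ s₃ ≠ 5 := by decide) :
    Establishes D
      (.block [.appendRange a r₁ s₁, .appendRange a r₂ s₂, .appendRange a r₃ s₃]) (21 * p + 10)
    (fun τ => (∀ x, x ≠ 5 → τ.reg x = σ.reg x) ∧ τ.mark = σ.mark ∧ ∀ b j, τ.rows b j =
      if b = a ∧ j = σ.reg 2 then σ.rows b j ++ (List.range' (σ.reg r₁) p ++
        (List.range' (σ.reg r₂) p ++ List.range' (σ.reg r₃) p)) else σ.rows b j) σ := by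
  refine .mono (T₁ := (7 * p + 3) + ((7 * p + 3) + ((7 * p + 3) + 1))) (R := _) (.cons
    ((establishes_appendRange ha h₁ hr₁.1 hs₁.1 hs₁.2).mono le_rfl ?_)) (by omega) fun _ h => h
  rintro τ ⟨h1, h2, h3⟩
  refine .cons ((establishes_appendRange ha (m := p)
    (by rw [h1 _ hr₂.2, h1 _ hs₂.2, h₂]) hr₂.1 hs₂.1 hs₂.2).mono le_rfl ?_)
  rintro υ ⟨h1', h2', h3'⟩
  refine .single ((establishes_appendRange ha (m := p)
    (by rw [h1' _ hr₃.2, h1' _ hs₃.2, h1 _ hr₃.2, h1 _ hs₃.2, h₃]) hr₃.1 hs₃.1 hs₃.2).mono le_rfl ?_)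
  rintro φ ⟨h1'', h2'', h3''⟩
  refine ⟨fun x hx => by rw [h1'' x hx, h1' x hx, h1 x hx], by rw [h2'', h2', h2], fun b j => ?_⟩
  rw [h3'', h3', h3, h1' 2 (by decide), h1 2 (by decide), h1' _ hr₃.2, h1 _ hr₃.2, h1 _ hr₂.2]
  split_ifs <;> simp

theorem establishes_fullLists {a : ℕ} {σ : Config} (ha : 1 ≤ a ∧ a ≤ 3)
    (hσ : StandardRegisters p q σ) :
    Establishes D (.fullLists a) (3 * p * (21 * p + 20) + 10)
    (fun τ => StandardRegisters p q τ ∧ τ.mark = σ.mark ∧ (∀ b, b ≠ a → τ.rows b = σ.rows b) ∧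
      ∀ i < 3 * p, τ.rows a i = fullRow p i) σ := by
  obtain ⟨h0, h1, h6, h7, h11, h12⟩ := hσ
  refine .mono (T₁ := _) (R := _) (.cons (.const (.single (.forLT (fun k τ =>
    StandardRegisters p q τ ∧ τ.reg 2 = k ∧ τ.mark = σ.mark ∧
      (∀ b, b ≠ a → τ.rows b = σ.rows b) ∧ ∀ i < k, τ.rows a i = fullRow p i)
    (fun _ => 21 * p + 18) 0 (b := 3 * p) (Nat.zero_le _) ?_ ?_ ?_ ?_)))) ?_ fun _ h => h
  · simp [StandardRegisters, *]
  · rintro k τ ⟨h, h2, -⟩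
    exact ⟨h2, h.2.2.2.1⟩
  · rintro k τ - hk ⟨⟨h0, h1, h6, h7, h11, h12⟩, h2, hm, hb, hr⟩
    -- Common to both branches of the test: only register 5 and row k may have changed.
    have final : ∀ υ : Config, (∀ x, x ≠ 5 → υ.reg x = τ.reg x) → υ.mark = τ.mark →
        (∀ b j, υ.rows b j = if b = a ∧ j = k then fullRow p k else τ.rows b j) →
        StandardRegisters p q (υ.set 2 (υ.reg 2 + 1)) ∧ (υ.set 2 (υ.reg 2 + 1)).reg 2 = k + 1 ∧
        (υ.set 2 (υ.reg 2 + 1)).mark = σ.mark ∧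
        (∀ b, b ≠ a → (υ.set 2 (υ.reg 2 + 1)).rows b = σ.rows b) ∧
        ∀ i < k + 1, (υ.set 2 (υ.reg 2 + 1)).rows a i = fullRow p i := by
      intro υ hreg hmark hrow
      refine ⟨by simp [StandardRegisters, *], by simp [*], by simp [*], ?_, ?_⟩
      · intro b hba
        funext j
        simp [hrow, hba, hb]
      · intro i hi
        by_cases hik : i = k
        · subst hik
          simp [hrow]
        · simp [hrow, hik, hr i (by omega)]
    refine .mono (T₁ := 1 + ((21 * p + 10 + 1) + 1)) (R := _) (.cons (.clear h11 (.single (.ifLT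
      (fun hlt => ?_) (fun hlt => ?_))) ha)) (by omega) fun _ h => h
    · have hkp : k < p := by simpa [h0, h2] using hlt
      refine (establishes_three_ranges ha (p := p) (by simp [*]; omega) (by simp [*])
        (by simp [*]; omega)).mono le_rfl ?_
      rintro υ ⟨e1, e2, e3⟩
      refine final υ (by simpa using e1) (by simpa using e2) fun b j => ?_
      rw [e3]
      by_cases hba : b = a
      · subst hba
        by_cases hj : j = k
        · subst hj
          simp [*, fullRow]
        · simp [*]
      · simp [hba]
    · have hkp : ¬ k < p := by simpa [h0, h2] using hlt
      refine (establishes_three_ranges ha (p := p) (by simp [*]; omega) (by simp [*])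
        (by simp [*]; omega)).mono le_rfl ?_
      rintro υ ⟨e1, e2, e3⟩
      refine final υ (by simpa using e1) (by simpa using e2) fun b j => ?_
      rw [e3]
      by_cases hba : b = a
      · subst hba
        by_cases hj : j = k
        · subst hj
          simp [*, fullRow]
        · simp [*]
      · simp [hba]
  · rintro τ ⟨h, -, hm, hb, hr⟩
    exact ⟨h, hm, hb, hr⟩
  · simp only [Finset.sum_const, Nat.card_Ico, smul_eq_mul, Nat.sub_zero, Nat.add_assoc,
      Nat.reduceAdd]
    omega

end

section

variable {D : ℕ → ℕ → ℕ} {p q : ℕ}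

theorem establishes_fillLists {a : ℕ} {σ : Config} (ha : 1 ≤ a ∧ a ≤ 3)
    (hσ : StandardRegisters p q σ) {row : ℕ → List ℕ} (hrow : ∀ i < 3 * p, σ.rows a i = row i)
    (hvalid : ValidRows (3 * p) row) (hmark : σ.mark = fun _ _ => 0) :
    Establishes D (.fillLists a) (3 * p * (45 * p + 20) + 10)
    (fun τ => StandardRegisters p q τ ∧ (∀ b, b ≠ a → τ.rows b = σ.rows b) ∧
      ∀ i < 3 * p, τ.rows a i = fillRow (3 * p) (row i)) σ := by
  obtain ⟨h0, h1, h6, h7, h11, h12⟩ := hσ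
  refine .mono (T₁ := _) (R := _) (.cons (.const (.single (.forLT (fun k τ =>
    StandardRegisters p q τ ∧ τ.reg 2 = k ∧ (∀ b, b ≠ a → τ.rows b = σ.rows b) ∧
      -- The mark rows that are still to be used are clean.
      (∀ i, k ≤ i → ∀ x, τ.mark i x = 0) ∧
      ∀ i < 3 * p, τ.rows a i = if i < k then fillRow (3 * p) (row i) else row i)
    (fun _ => 45 * p + 18) 0 (b := 3 * p) (Nat.zero_le _) ?_ ?_ ?_ ?_)))) ?_ fun _ h => h
  · simpa [StandardRegisters, *] using hrow
  · rintro k τ ⟨h, h2, -⟩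
    exact ⟨h2, h.2.2.2.1⟩
  · rintro k τ - hk ⟨⟨h0, h1, h6, h7, h11, h12⟩, h2, hb, hm, hr⟩
    have hrk : τ.rows a k = row k := by rw [hr k hk, if_neg (lt_irrefl k)]
    -- A row without repetitions is short, so marking its entries takes O(p) steps.
    have hlen : (row k).length ≤ 3 * p := by
      have := (List.subperm_of_subset (hvalid k hk).1 (l₂ := List.range (3 * p)) fun x hx =>
        List.mem_range.2 ((hvalid k hk).2 x hx)).length_le
      simpa using this
    refine .mono (T₁ := 1 + (1 + (1 + ((∑ _k ∈ Finset.Ico 1 ((row k).length + 1), (3 + 2) + 1) +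
      (1 + ((∑ _k ∈ Finset.Ico 0 (3 * p), (8 + 2) + 1) + 1)))))) (R := _)
      (.cons (.load_length h11 (.cons (.inc (.cons (.const (.cons (.forLT (fun m υ =>
        StandardRegisters p q υ ∧ υ.reg 2 = k ∧ υ.reg 5 = m ∧ υ.reg 8 = (row k).length + 1 ∧
        υ.rows = τ.rows ∧ (∀ i, k < i → ∀ x, υ.mark i x = 0) ∧
        ∀ x, υ.mark k x = if x ∈ (row k).take (m - 1) then 1 else 0)
      (fun _ => 3) 1 (b := (row k).length + 1) (Nat.le_add_left _ _) ?_ ?_ ?_ ?_)))))) ha)) ?_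
      fun _ h => h
    · refine ⟨by simp [StandardRegisters, *], by simp [*], by simp, by simp [*], by simp, ?_, ?_⟩
      · intro i hi x
        simp [hm i hi.le]
      · intro x
        simp [hm k le_rfl]
    · rintro m υ ⟨-, -, h5, h8, -⟩
      exact ⟨h5, h8⟩
    · rintro m υ hm1 hml ⟨⟨h0, h1, h6, h7, h11, h12⟩, h2', h5, h8, hrows, hmk, hmx⟩
      obtain ⟨m, rfl⟩ := Nat.exists_eq_add_of_le' hm1
      have hml' : m < (row k).length := by omega
      have hrow' : υ.rows a (υ.reg 2) = row k := by rw [h2', hrows, hrk]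
      refine .cons (.load_entry (k := m) h5 (by rwa [hrow']) (.cons (.store_mark (.nil ?_))) ha)
      have hrow'' : υ.rows a k = row k := by rw [hrows, hrk]
      refine ⟨by simp [StandardRegisters, *], by simp [*], by simp [*], by simp [*], by simp [*],
        ?_, ?_⟩
      · intro i hi x
        simp [h2', hi.ne', hmk i hi]
      · intro x
        have htake : x ∈ (row k).take (m + 1 + 1 - 1) ↔
            x ∈ (row k).take m ∨ x = (row k)[m] := by
          rw [Nat.add_sub_cancel, ← List.take_append_getElem hml', List.mem_append,
            List.mem_singleton]
        simp only [htake]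
        rw [Nat.add_sub_cancel] at hmx
        by_cases hx : x = (row k)[m]
        · simp [h2', h12, hrow'', hx]
        · simp [h2', hrow'', hx, hmx]
    · rintro υ ⟨⟨h0, h1, h6, h7, h11, h12⟩, h2', h5, h8, hrows, hmk, hmx⟩
      rw [Nat.add_sub_cancel, List.take_length] at hmx
      refine .cons (.const (.single (.forLT (fun m φ =>
        StandardRegisters p q φ ∧ φ.reg 2 = k ∧ φ.reg 5 = m ∧ φ.mark = υ.mark ∧ ∀ b i, φ.rows b i =
          if b = a ∧ i = k then row k ++ (List.range m).filter (· ∉ row k) else τ.rows b i)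
        (fun _ => 8) 0 (b := 3 * p) (Nat.zero_le _) ?_ ?_ ?_ ?_)))
      · refine ⟨by simp [StandardRegisters, *], by simp [*], by simp, by simp, fun b i => ?_⟩
        by_cases hbi : b = a ∧ i = k
        · simp [hbi.1, hbi.2, hrows, hrk]
        · simp [hbi, hrows]
      · rintro m φ ⟨h, -, h5, -⟩
        exact ⟨h5, h.2.2.2.1⟩
      · rintro m φ - hm3 ⟨⟨h0, h1, h6, h7, h11, h12⟩, h2'', h5', hmark, hrows'⟩
        refine .cons (.load_mark (.single (T := 6) (.ifLT (T := 5) ?_ ?_)))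
        · intro hlt
          have hmem : m ∉ row k := by
            intro hmem
            simp [h12, h2'', h5', hmark, hmx, hmem] at hlt
          refine .append ⟨by simp [StandardRegisters, *], by simp [*], by simp [*], by simp [*],
            fun b i => ?_⟩ ha
          rw [List.range_succ, List.filter_append]
          by_cases hba : b = a
          · subst hba
            by_cases hik : i = k
            · subst hik
              simp [h2'', h5', hrows', hmem]
            · simp [h2'', hrows', hik]
          · simp [hba, hrows']
        · intro hlt
          have hmem : m ∈ row k := by
            by_contra hmem
            simp [h12, h2'', h5', hmark, hmx, hmem] at hlt
          refine (Establishes.skip ⟨by simp [StandardRegisters, *], by simp [*], by simp [*],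
            by simp [*], fun b i => ?_⟩).mono (T₁ := 1) (by omega) fun _ h => h
          rw [List.range_succ, List.filter_append]
          simp [hrows', hmem]
      · rintro φ ⟨h, h2'', h5, hmark, hrows'⟩
        refine ⟨by simpa [StandardRegisters] using h, by simp [h2''], ?_, ?_, ?_⟩
        · intro b hba
          funext i
          simp [hrows', hba, hb]
        · intro i hi x
          simp [hmark, hmk i (by omega)]
        · intro i hi
          by_cases hik : i = k
          · subst hik
            simp [hrows', fillRow]
          · have : i < k + 1 ↔ i < k := by omega
            simp [hrows', hik, this, hr i hi]
    · simp
      omega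
  · rintro τ ⟨h, -, hb, -, hr⟩
    exact ⟨h, hb, fun i hi => by rw [hr i hi, if_pos hi]⟩
  · simp only [Finset.sum_const, Nat.card_Ico, smul_eq_mul, Nat.sub_zero, Nat.add_assoc,
      Nat.reduceAdd]
    omega

/-! ### Assembling the three constructions. -/

/-- Register 0 holds p while the lists are written; the output format wants the size 3 * p there. -/
theorem Establishes.finish {c : Program} {T : ℕ} {rowM rowW : ℕ → List ℕ} {σ : Config}
    (h : Establishes D c T (fun τ => StandardRegisters p q τ ∧
      (∀ i < 3 * p, τ.rows 1 i = rowM i) ∧ ∀ i < 3 * p, τ.rows 2 i = rowW i) σ) :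
    Establishes D (.seq c (.copy 0 7)) (T + 1) (fun τ => τ.reg 0 = 3 * p ∧
      (∀ i < 3 * p, τ.rows 1 i = rowM i) ∧ ∀ i < 3 * p, τ.rows 2 i = rowW i) σ := by
  refine .seq (h.mono le_rfl ?_)
  rintro τ ⟨⟨-, -, -, h7, -⟩, hM, hW⟩
  exact .copy ⟨by simp [h7], by simpa using hM, by simpa using hW⟩

theorem holdsLists_toFinList {n : ℕ} {A : ℕ → ℕ → ℕ} {f row : ℕ → List ℕ} (h : HoldsRows A f)
    (hf : ∀ i < n, f i = row i) (hv : ValidRows n row) :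
    HoldsLists A fun i : Fin n => toFinList n (row i) := by
  intro i
  have hmap := map_toFinList (hv i i.2).2
  have hlen : (toFinList n (row i)).length = (row i).length := by
    rw [← List.length_map (f := Fin.val), hmap]
  have hi := h i
  rw [hf i i.2] at hi
  refine ⟨by rw [hlen]; exact hi.1, fun k hk => ?_⟩
  have hk' : k < (row i).length := by simpa [hlen] using hk
  rw [hi.2 k hk', ← List.getElem_map Fin.val (h := by simpa using hk)]
  simp only [hmap]

/-- A program that writes down the rows of a realizing instance constructs that instance. -/
theorem constructsRealizers_of_rows {T : ℕ → ℕ} {Q : ∀ n : ℕ, SMInstance n → Prop} {c : Program}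
    {K : ℕ} {B : ℕ → ℕ → ℕ} (hB : ∀ p q, B p q + 1 ≤ K * (T (p + q) + 1)) (hK : 6 ≤ K)
    {rowM rowW : ℕ → List (ℕ × ℕ) → ℕ → List ℕ}
    (h : ∀ (X : Type u) [PartialOrder X] (p q : ℕ) (v : Fin p ≃ X) (E : Fin q → Fin p × Fin p),
      IsHasseDiagram v E → ValidRows (3 * p) (rowM p (edgeList E)) ∧
        ValidRows (3 * p) (rowW p (edgeList E)) ∧
        (∃ I : SMInstance (3 * p), I.toPreferences =
          rowPreferences (3 * p) (rowM p (edgeList E)) (rowW p (edgeList E)) ∧ I.Realizes X) ∧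
        (∀ I : SMInstance (3 * p), I.toPreferences =
          rowPreferences (3 * p) (rowM p (edgeList E)) (rowW p (edgeList E)) → Q _ I) ∧
        Establishes ((inputState E).mem 0) c (B p q) (fun τ => StandardRegisters p q τ ∧
          (∀ i < 3 * p, τ.rows 1 i = rowM p (edgeList E) i) ∧
          ∀ i < 3 * p, τ.rows 2 i = rowW p (edgeList E) i) (initialConfig p q)) :
    ConstructsRealizers.{u} T Q := by
  refine ⟨.seq c (.copy 0 7), K, fun X _ p q v E hE => ?_⟩
  obtain ⟨hM, hW, ⟨I, hI, hreal⟩, hQ, hc⟩ := h X p q v E hE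
  obtain ⟨t, s, σ, hruns, ht, hs, h0, hM', hW'⟩ := hc.finish _ (represents_inputState E)
  refine ⟨3 * p, I, t, s, hQ I hI, hreal, ?_, hruns, ht.trans (hB p q), ?_, ?_, ?_⟩
  · calc 3 * p + 3 * p ≤ 6 * (p + q) := by omega
      _ ≤ K * (p + q) := Nat.mul_le_mul_right _ hK
  · rw [hs.reg 0 (by decide), h0]
  · rw [show I.man = _ from congrArg Preferences.man hI]
    exact holdsLists_toFinList (hs.rows 1 (by decide) (by decide)) hM' hM
  · rw [show I.woman = _ from congrArg Preferences.woman hI]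
    exact holdsLists_toFinList (hs.rows 2 (by decide) (by decide)) hW' hW

theorem constructsRealizers_sublists : ConstructsRealizers.{u} (fun N => N)
    (fun _ I => SublistsOfTwo I.man ∧ SublistsOfTwo I.woman) := by
  refine constructsRealizers_of_rows (c := .coreLists) (K := 300)
    (B := fun p q => 200 * (p + q) + 200) (fun p q => by omega) (by decide)
    (rowM := fun p l => coreRow p (predRow p l)) (rowW := fun p l => coreRow p (succRow p l)) ?_
  intro X _ p q v E hE
  refine ⟨validRows_coreRow (predRow_lt _) (predRow_nodup _),
    validRows_coreRow (succRow_lt _) (succRow_nodup _), exists_core_instance hE, fun I hI => ?_,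
    (establishes_coreLists hE.1).mono le_rfl fun τ h => ⟨h.1, h.2.2⟩⟩
  rw [hI]
  exact ⟨sublistsOfTwo_coreRow fun _ => rfl, sublistsOfTwo_coreRow fun _ => rfl⟩

theorem quadratic_bound (p q : ℕ) : 200 * (p + q) + 200 + (3 * p * (21 * p + 20) + 10 +
    (3 * p * (45 * p + 20) + 10 + 1)) + 1 ≤ 1000 * ((p + q) ^ 2 + 1) := by
  nlinarith [Nat.zero_le (p * q), Nat.le_self_pow two_ne_zero q, Nat.le_self_pow two_ne_zero p]

theorem constructsRealizers_men : ConstructsRealizers.{u} (fun N => N ^ 2)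
    (fun _ I => I.HasListPreferences 2 ⊤) := by
  -- The incomplete lists of the men are needed for the transposition into array 2; only then are
  -- they replaced.
  refine constructsRealizers_of_rows (c := .block [.coreLists, .fullLists 1, .fillLists 2])
    (K := 1000) quadratic_bound (by decide) (rowM := fun p _ => fullRow p)
    (rowW := fun p l i => fillRow (3 * p) (coreRow p (succRow p l) i)) ?_
  intro X _ p q v E hE
  have hW := validRows_coreRow (succRow_lt (p := p) (edgeList E)) (succRow_nodup _)
  refine ⟨validRows_fullRow, validRows_fillRow hW, exists_men_instance hE, fun I hI => ?_, ?_⟩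
  · rw [SMInstance.HasListPreferences, hI]
    exact ⟨fun m => isCompleteList_fullRow m, fun w => isCompleteList_fillRow hW w.2,
      inGroups_fullRow, inGroups_top _⟩
  · refine .chain (establishes_coreLists hE.1) le_rfl ?_
    rintro τ ⟨hτ, hm, -, hr⟩
    refine .chain (establishes_fullLists (by decide) hτ) le_rfl ?_
    rintro υ ⟨hυ, hm', hb, hr'⟩
    -- The array 4 is still zero, as neither of the preceding programs writes marks.
    refine .single ((establishes_fillLists (by decide) hυ (fun i hi => ?_) hW
      (hm'.trans hm)).mono le_rfl ?_)
    · rw [hb 2 (by decide), hr i hi]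
    · rintro φ ⟨hφ, hb', hr''⟩
      exact ⟨hφ, fun i hi => by rw [hb' 1 (by decide), hr' i hi], hr''⟩

theorem constructsRealizers_women : ConstructsRealizers.{u} (fun N => N ^ 2)
    (fun _ I => I.HasListPreferences ⊤ 2) := by
  refine constructsRealizers_of_rows (c := .block [.coreLists, .fullLists 2, .fillLists 1])
    (K := 1000) quadratic_bound (by decide)
    (rowM := fun p l i => fillRow (3 * p) (coreRow p (predRow p l) i))
    (rowW := fun p _ => fullRow p) ?_
  intro X _ p q v E hE
  have hM := validRows_coreRow (predRow_lt (p := p) (edgeList E)) (predRow_nodup _)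
  refine ⟨validRows_fillRow hM, validRows_fullRow, exists_women_instance hE, fun I hI => ?_, ?_⟩
  · rw [SMInstance.HasListPreferences, hI]
    exact ⟨fun m => isCompleteList_fillRow hM m.2, fun w => isCompleteList_fullRow w,
      inGroups_top _, inGroups_fullRow⟩
  · refine .chain (establishes_coreLists hE.1) le_rfl ?_
    rintro τ ⟨hτ, hm, hr, -⟩
    refine .chain (establishes_fullLists (by decide) hτ) le_rfl ?_
    rintro υ ⟨hυ, hm', hb, hr'⟩
    refine .single ((establishes_fillLists (by decide) hυ (fun i hi => ?_) hM
      (hm'.trans hm)).mono le_rfl ?_)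
    · rw [hb 1 (by decide), hr i hi]
    · rintro φ ⟨hφ, hb', hr''⟩
      exact ⟨hφ, hr'', fun i hi => by rw [hb' 2 (by decide), hr' i hi]⟩

end

theorem mainTheorem5 :
    ConstructsRealizers.{u} (fun N => N)
      (fun _ I => SublistsOfTwo I.man ∧ SublistsOfTwo I.woman) ∧
    ConstructsRealizers.{u} (fun N => N ^ 2) (fun _ I => I.HasListPreferences 2 ⊤) ∧
    ConstructsRealizers.{u} (fun N => N ^ 2) (fun _ I => I.HasListPreferences ⊤ 2) :=
  ⟨constructsRealizers_sublists, constructsRealizers_men, constructsRealizers_women⟩
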